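/- Let $d,m,n$ be non-negative integers, let $f_1,\dots,f_m,u_1,\dots,u_n,v_1,\dots,v_n\in\mathcal D(\mathbb R^d)'$ be complex-valued Schwartz distributions on $\mathbb R^d$, and let $c_1,\dots,c_m\in GL(d,\mathbb R)$ be such that $c_i-c_j$ is invertible whenever $i\neq j$. Suppose that $$\sum_{i=1}^m f_i(x+c_iy)=\sum_{k=1}^n u_k(y)\,v_k(x)$$ as elements of $\mathcal D(\mathbb R^d\times\mathbb R^d)'$. Here $f_i(x+c_iy)$ is the distribution $\varphi\mapsto\left\langle f_i(z),\int_{\mathbb R^d}\varphi(z-c_iy,y)\,dy\right\rangle$, and $u_k(y)v_k(x)$ is the tensor product $\varphi\mapsto\left\langle v_k(x),\langle u_k(y),\varphi(x,y)\rangle\right\rangle$. Then every $f_i$ ($1\le i\le m$) is a continuous exponential polynomial: there are finitely many polynomials $p_1,\dots,p_N$ in $d$ variables with complex coefficients and vectors $\lambda_1,\dots,\lambda_N\in\mathbb C^d$ such that $f_i$ is the distribution given by the function $x\mapsto\sum_{j=1}^N p_j(x)\,e^{\langle\lambda_j,x\rangle}$, where $\langle\lambda,x\rangle=\sum_{l=1}^d\lambda_l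 x_l$. -/

import Mathlib

open TopologicalSpace MeasureTheory
open scoped Distributions ContDiff

/-- The space of complex-valued Schwartz distributions on a normed space `E`: continuous
`ℂ`-linear functionals on the space of complex-valued test functions, with its canonical
LF topology. -/
abbrev CDistribution (E : Type) [NormedAddCommGroup E] [NormedSpace ℝ E] : Type :=
  𝓓((⊤ : Opens E), ℂ) →L[ℂ] ℂ

namespace CDistribution

section Taylor

variable {V : Type} [NormedAddCommGroup V] [NormedSpace ℝ V]

/-- First order Taylor estimate, for a function and for all its derivatives. -/
theorem taylor_bound (i : ℕ) : ∀ {F : Type} [NormedAddCommGroup F] [NormedSpace ℝ F]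
    (f : V → F), ContDiff ℝ ∞ f → (∀ j : ℕ, ∃ C, ∀ x, ‖iteratedFDeriv ℝ j f x‖ ≤ C) →
    ∃ C, 0 ≤ C ∧ ∀ v x, ‖iteratedFDeriv ℝ i (fun z => f (z + v) - f z - fderiv ℝ f z v) x‖
      ≤ C * ‖v‖ ^ 2 := by
  induction i with
  | zero =>
    intro F _ _ f hf hb
    obtain ⟨C, hC⟩ := hb 2
    have hC0 : 0 ≤ C := (norm_nonneg _).trans (hC 0)
    refine ⟨C, hC0, fun v x => ?_⟩
    rw [norm_iteratedFDeriv_zero]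
    have hf1 : ContDiff ℝ ∞ (fderiv ℝ f) := hf.fderiv_right (by simp)
    have hd : Differentiable ℝ (fderiv ℝ f) := hf1.differentiable (by simp)
    have hC' : ∀ z, ‖fderiv ℝ (fderiv ℝ f) z‖ ≤ C := fun z => by
      rw [← norm_iteratedFDeriv_one, norm_iteratedFDeriv_fderiv]; exact hC z
    have key := (convex_segment (𝕜 := ℝ) x (x + v)).norm_image_sub_le_of_norm_fderiv_le'
      (f := f) (φ := fderiv ℝ f x) (C := C * ‖v‖) (𝕜 := ℝ)
      (fun z _ => (hf.differentiable (by simp)) z)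
      (fun z hz => by
        have h1 := convex_univ.norm_image_sub_le_of_norm_fderiv_le (𝕜 := ℝ) (f := fderiv ℝ f)
          (C := C) (fun z _ => hd z) (fun z _ => hC' z) (Set.mem_univ x) (Set.mem_univ z)
        refine h1.trans (mul_le_mul_of_nonneg_left ?_ hC0)
        have := norm_sub_le_of_mem_segment hz
        simpa using this)
      (left_mem_segment ℝ x (x + v)) (right_mem_segment ℝ x (x + v))
    rw [add_sub_cancel_left] at key
    exact key.trans (le_of_eq (by ring))
  | succ i ih =>
    intro F _ _ f hf hb
    have hf1 : ContDiff ℝ ∞ (fderiv ℝ f) := hf.fderiv_right (by simp)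
    obtain ⟨C, hC0, hC⟩ := ih (fderiv ℝ f) hf1 (fun j => by
      obtain ⟨C, hC⟩ := hb (j + 1)
      exact ⟨C, fun x => by rw [norm_iteratedFDeriv_fderiv]; exact hC x⟩)
    refine ⟨C, hC0, fun v x => ?_⟩
    rw [← norm_iteratedFDeriv_fderiv]
    have : fderiv ℝ (fun z => f (z + v) - f z - fderiv ℝ f z v) =
        fun z => fderiv ℝ f (z + v) - fderiv ℝ f z - fderiv ℝ (fderiv ℝ f) z v := by
      funext z
      have hd : Differentiable ℝ f := hf.differentiable (by simp)
      have hd1 : Differentiable ℝ (fderiv ℝ f) := hf1.differentiable (by simp)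
      have e1 : HasFDerivAt (fun z => f (z + v)) (fderiv ℝ f (z + v)) z := by
        exact (hd (z + v)).hasFDerivAt.comp z ((hasFDerivAt_id z).add_const v)
      have e3 : HasFDerivAt (fun z => fderiv ℝ f z v)
          ((ContinuousLinearMap.apply ℝ F v).comp (fderiv ℝ (fderiv ℝ f) z)) z :=
        (ContinuousLinearMap.apply ℝ F v).hasFDerivAt.comp z (hd1 z).hasFDerivAt
      refine ((e1.sub (hd z).hasFDerivAt).sub e3).fderiv.trans ?_
      ext w
      have hs : IsSymmSndFDerivAt ℝ f z :=
        hf.contDiffAt.isSymmSndFDerivAt (by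
          rw [minSmoothness_of_isRCLikeNormedField]; exact WithTop.coe_le_coe.2 le_top)
      simp [hs.eq v w]
    rw [this]
    exact hC v x

end Taylor

section Bound

variable {E : Type} [NormedAddCommGroup E] [NormedSpace ℝ E]

/-- A distribution has finite order on every compact set. -/
theorem exists_bound (u : CDistribution E) (K : Compacts E) :
    ∃ (N : ℕ) (C : ℝ), 0 ≤ C ∧ ∀ (ψ : 𝓓((⊤ : Opens E), ℂ)), (∀ x, x ∉ K → ψ x = 0) →
      ∀ B : ℝ, 0 ≤ B → (∀ i ≤ N, ∀ x, ‖iteratedFDeriv ℝ i ψ x‖ ≤ B) → ‖u ψ‖ ≤ C * B := by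
  let T : 𝓓_{K}(E, ℂ) →L[ℂ] ℂ :=
    u.comp (TestFunction.ofSupportedInCLM ℂ (Ω := (⊤ : Opens E)) (n := ⊤) (Set.subset_univ (K : Set E)))
  let q : Seminorm ℂ 𝓓_{K}(E, ℂ) := (normSeminorm ℂ ℂ).comp T.toLinearMap
  have hq : Continuous q := continuous_norm.comp T.continuous
  obtain ⟨s, C, -, h⟩ := Seminorm.bound_of_continuous
    (ContDiffMapSupportedIn.withSeminorms ℂ E ℂ ⊤ K) q hq
  refine ⟨s.sup id, C, C.2, fun ψ hψ B hB hi => ?_⟩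
  let ψ' : 𝓓_{K}(E, ℂ) := ⟨ψ, ψ.contDiff, fun x hx => hψ x hx⟩
  have h1 := h ψ'
  have h2 : (s.sup (ContDiffMapSupportedIn.seminorm ℂ E ℂ ⊤ K)) ψ' ≤ B := by
    refine Seminorm.finset_sup_apply_le hB fun i his => ?_
    rw [ContDiffMapSupportedIn.seminorm_top_le_iff ℂ hB]
    exact fun x _ => hi i (Finset.le_sup (f := id) his) x
  calc ‖u ψ‖ = q ψ' := rfl
    _ ≤ C * (s.sup (ContDiffMapSupportedIn.seminorm ℂ E ℂ ⊤ K)) ψ' := h1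
    _ ≤ C * B := mul_le_mul_of_nonneg_left h2 C.2

end Bound

section Comp

variable {V W : Type} [NormedAddCommGroup V] [NormedSpace ℝ V]
  [NormedAddCommGroup W] [NormedSpace ℝ W]

/-- Constructor for continuous linear maps between spaces of smooth functions with support in
given compact sets of two different spaces. -/
noncomputable def mkSupportedIn {K : Compacts V} {K' : Compacts W}
    (A : 𝓓_{K}(V, ℂ) → W → ℂ)
    (hadd : ∀ f g x, A (f + g) x = A f x + A g x)
    (hsmul : ∀ (c : ℂ) f x, A (c • f) x = c • A f x)
    (hsmooth : ∀ f, ContDiff ℝ ∞ (A f))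
    (hsupp : ∀ f, Set.EqOn (A f) 0 (K' : Set W)ᶜ)
    (hbound : ∀ i : ℕ, ∃ (s : Finset ℕ) (C : NNReal), ∀ f x,
      ‖iteratedFDeriv ℝ i (A f) x‖ ≤ C * (s.sup fun j => N[ℂ]_{K, j}) f) :
    𝓓_{K}(V, ℂ) →L[ℂ] 𝓓_{K'}(W, ℂ) :=
  letI Φ : 𝓓_{K}(V, ℂ) →ₗ[ℂ] 𝓓_{K'}(W, ℂ) :=
    { toFun := fun f => ⟨A f, hsmooth f, hsupp f⟩
      map_add' := fun f g => ContDiffMapSupportedIn.ext (hadd f g)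
      map_smul' := fun c f => ContDiffMapSupportedIn.ext (hsmul c f) }
  { toLinearMap := Φ
    cont := show Continuous Φ by
      refine WithSeminorms.continuous_of_isBounded (ContDiffMapSupportedIn.withSeminorms ℂ V ℂ ⊤ K)
        (ContDiffMapSupportedIn.withSeminorms ℂ W ℂ ⊤ K') _ (fun i => ?_)
      obtain ⟨s, C, h⟩ := hbound i
      exact ⟨s, C, fun f => (ContDiffMapSupportedIn.seminorm_top_le_iff ℂ
        (mul_nonneg C.2 (apply_nonneg _ _)) i (Φ f)).2 fun x _ => h f x⟩ }

/-- Composition with a linear isomorphism, on the test functions supported in `K`. -/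
noncomputable def compTestSupportedIn (A : V ≃L[ℝ] W) (K : Compacts W) (K' : Compacts V)
    (hK : A ⁻¹' K ⊆ K') : 𝓓_{K}(W, ℂ) →L[ℂ] 𝓓_{K'}(V, ℂ) :=
  mkSupportedIn (fun φ x => φ (A x)) (fun _ _ _ => rfl) (fun _ _ _ => rfl)
    (fun φ => φ.contDiff.comp A.contDiff)
    (fun φ x hx => φ.zero_on_compl fun h => hx (hK h))
    (fun i => ⟨{i}, ‖(A : V →L[ℝ] W)‖₊ ^ i, fun φ x => by
      have h := (A : V →L[ℝ] W).iteratedFDeriv_comp_right φ.contDiff x (i := i)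
        (by exact_mod_cast le_top)
      change ‖iteratedFDeriv ℝ i (φ ∘ (A : V →L[ℝ] W)) x‖ ≤ _
      rw [h, Finset.sup_singleton]
      refine (ContinuousMultilinearMap.norm_compContinuousLinearMap_le _ _).trans ?_
      rw [Finset.prod_const, Finset.card_univ, Fintype.card_fin, mul_comm, NNReal.coe_pow,
        coe_nnnorm]
      exact mul_le_mul_of_nonneg_left
        (ContDiffMapSupportedIn.norm_iteratedFDeriv_apply_le_seminorm_top ℂ)
        (by positivity)⟩)

/-- Composition of test functions with a linear isomorphism, `φ ↦ φ ∘ A`. -/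
noncomputable def compTest (A : V ≃L[ℝ] W) :
    𝓓((⊤ : Opens W), ℂ) →L[ℂ] 𝓓((⊤ : Opens V), ℂ) :=
  TestFunction.limitCLM ℂ
    (fun φ => ⟨fun x => φ (A x), φ.contDiff.comp A.contDiff,
      φ.hasCompactSupport.comp_homeomorph A.toHomeomorph, Set.subset_univ _⟩)
    (fun K _ => (TestFunction.ofSupportedInCLM ℂ (Set.subset_univ _)).comp
      (compTestSupportedIn A K
        ⟨A ⁻¹' K, A.toHomeomorph.isCompact_preimage.2 K.isCompact⟩ subset_rfl))
    (fun _ _ _ => rfl)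

end Comp

section Pair

variable {E : Type} [NormedAddCommGroup E] [NormedSpace ℝ E]

/-- The slice `y ↦ φ (x, y)` of a test function on `E × E`. -/
noncomputable def slice (φ : 𝓓((⊤ : Opens (E × E)), ℂ)) (x : E) : 𝓓((⊤ : Opens E), ℂ) where
  toFun y := φ (x, y)
  contDiff' := φ.contDiff.comp (contDiff_const.prodMk contDiff_id)
  hasCompactSupport' := HasCompactSupport.intro (φ.hasCompactSupport.image continuous_snd)
    fun y hy => image_eq_zero_of_notMem_tsupport fun h => hy ⟨(x, y), h, rfl⟩
  tsupport_subset' := Set.subset_univ _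

theorem norm_iteratedFDeriv_comp_inr_le (f : E × E → ℂ) (hf : ContDiff ℝ ∞ f) (i : ℕ)
    (x y : E) : ‖iteratedFDeriv ℝ i (fun y => f (x, y)) y‖ ≤ ‖iteratedFDeriv ℝ i f (x, y)‖ := by
  have hg : ContDiff ℝ ∞ (fun z => f (z + (x, 0))) :=
    hf.comp (contDiff_id.add contDiff_const)
  have h := (ContinuousLinearMap.inr ℝ E E).iteratedFDeriv_comp_right hg y (i := i)
    (by exact_mod_cast le_top)
  have e : (fun y => f (x, y)) = (fun z => f (z + (x, 0))) ∘ ContinuousLinearMap.inr ℝ E E := by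
    funext y; simp
  rw [e, h, iteratedFDeriv_comp_add_right]
  refine (ContinuousMultilinearMap.norm_compContinuousLinearMap_le _ _).trans ?_
  rw [Finset.prod_const]
  refine (mul_le_of_le_one_right (norm_nonneg _) (pow_le_one₀ (norm_nonneg _)
    (ContinuousLinearMap.norm_inr_le_one ℝ E E))).trans (le_of_eq ?_)
  simp

/-- The derivative of a test function on `E × E` in the direction `(v, 0)`. -/
noncomputable def dfst (v : E) (φ : 𝓓((⊤ : Opens (E × E)), ℂ)) : 𝓓((⊤ : Opens (E × E)), ℂ) :=
  TestFunction.lineDerivCLM ℂ (v, (0 : E)) φ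

theorem dfst_coe (v : E) (φ : 𝓓((⊤ : Opens (E × E)), ℂ)) :
    (dfst v φ : E × E → ℂ) = fun z => fderiv ℝ φ z (v, 0) := by
  funext z
  rw [dfst, TestFunction.lineDerivCLM_eq_fderivCLM, TestFunction.fderivCLM_apply_of_le]
  simp

theorem dfst_eq_zero (v : E) (φ : 𝓓((⊤ : Opens (E × E)), ℂ)) {z : E × E} (hz : z ∉ tsupport φ) :
    dfst v φ z = 0 := by
  rw [dfst_coe]
  have : fderiv ℝ φ z = 0 :=
    image_eq_zero_of_notMem_tsupport fun h => hz (tsupport_fderiv_subset ℝ h)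
  simp [this]

theorem norm_iteratedFDeriv_dfst_le (v : E) (φ : 𝓓((⊤ : Opens (E × E)), ℂ)) (i : ℕ) (z : E × E) :
    ‖iteratedFDeriv ℝ i (dfst v φ) z‖ ≤ ‖iteratedFDeriv ℝ (i + 1) φ z‖ * ‖v‖ := by
  rw [dfst_coe]
  have hf1 : ContDiff ℝ ∞ (fderiv ℝ φ) := φ.contDiff.fderiv_right (by simp)
  have h := (ContinuousLinearMap.apply ℝ ℂ ((v, 0) : E × E)).iteratedFDeriv_comp_left
    (hf1.contDiffAt (x := z)) (i := i) (by exact_mod_cast le_top)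
  change ‖iteratedFDeriv ℝ i (ContinuousLinearMap.apply ℝ ℂ ((v, 0) : E × E) ∘ fderiv ℝ φ) z‖ ≤ _
  rw [h, ← norm_iteratedFDeriv_fderiv]
  refine ContinuousMultilinearMap.opNorm_le_bound (by positivity) fun m => ?_
  calc _ ≤ ‖iteratedFDeriv ℝ i (fderiv ℝ φ) z m‖ * ‖((v, 0) : E × E)‖ :=
        (iteratedFDeriv ℝ i (fderiv ℝ φ) z m).le_opNorm _
    _ ≤ (‖iteratedFDeriv ℝ i (fderiv ℝ φ) z‖ * ∏ j, ‖m j‖) * ‖v‖ := by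
        gcongr
        · exact ContinuousMultilinearMap.le_opNorm _ _
        · simp [Prod.norm_def]
    _ = _ := by ring

/-- The function `x ↦ u (y ↦ φ (x, y))`. -/
noncomputable def pairFun (u : CDistribution E) (φ : 𝓓((⊤ : Opens (E × E)), ℂ)) (x : E) : ℂ :=
  u (slice φ x)

theorem pairFun_add (u : CDistribution E) (φ ψ : 𝓓((⊤ : Opens (E × E)), ℂ)) (x : E) :
    pairFun u (φ + ψ) x = pairFun u φ x + pairFun u ψ x :=
  map_add u (slice φ x) (slice ψ x)

theorem pairFun_smul (u : CDistribution E) (c : ℂ) (φ : 𝓓((⊤ : Opens (E × E)), ℂ)) (x : E) :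
    pairFun u (c • φ) x = c • pairFun u φ x :=
  map_smul u c (slice φ x)

theorem pairFun_eq_zero (u : CDistribution E) (φ : 𝓓((⊤ : Opens (E × E)), ℂ)) {x : E}
    (hx : ∀ y, φ (x, y) = 0) : pairFun u φ x = 0 := by
  have : slice φ x = 0 := TestFunction.ext hx
  rw [pairFun, this, map_zero]

variable [FiniteDimensional ℝ E]

/-- The derivative `v ↦ u (y ↦ ∂_{(v, 0)} φ (x, y))`. -/
noncomputable def pairDeriv (u : CDistribution E) (φ : 𝓓((⊤ : Opens (E × E)), ℂ)) (x : E) :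
    E →L[ℝ] ℂ :=
  LinearMap.toContinuousLinearMap
    { toFun := fun v => pairFun u (dfst v φ) x
      map_add' := fun v w => by
        rw [← pairFun_add]
        congr 1
        ext z
        change dfst (v + w) φ z = dfst v φ z + dfst w φ z
        simp only [dfst_coe]
        rw [← map_add]
        simp
      map_smul' := fun c v => by
        have : dfst (c • v) φ = (c : ℂ) • dfst v φ := by
          ext z
          change dfst (c • v) φ z = (c : ℂ) * dfst v φ z
          simp only [dfst_coe]
          rw [show ((c • v, 0) : E × E) = c • (v, 0) by simp, map_smul]
          simp
        rw [this, pairFun_smul]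
        simp }

theorem hasFDerivAt_pairFun (u : CDistribution E) (φ : 𝓓((⊤ : Opens (E × E)), ℂ)) (x : E) :
    HasFDerivAt (pairFun u φ) (pairDeriv u φ x) x := by
  let K : Compacts E := ⟨Prod.snd '' tsupport φ, φ.hasCompactSupport.image continuous_snd⟩
  obtain ⟨N, C, hC0, hC⟩ := exists_bound u K
  have hφb : ∀ j : ℕ, ∃ C, ∀ x, ‖iteratedFDeriv ℝ j φ x‖ ≤ C := fun j =>
    (φ.contDiff.continuous_iteratedFDeriv (by exact_mod_cast le_top)).bounded_above_of_compact_support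
      (φ.hasCompactSupport.iteratedFDeriv j)
  choose D hD0 hD using fun i => taylor_bound i φ φ.contDiff hφb
  rw [hasFDerivAt_iff_isLittleO_nhds_zero]
  have hO : (fun h => pairFun u φ (x + h) - pairFun u φ x - pairDeriv u φ x h) =O[nhds 0]
      fun h : E => ‖h‖ ^ 2 := by
    refine Asymptotics.IsBigO.of_bound (C * ∑ i ∈ Finset.range (N + 1), D i)
      (Filter.Eventually.of_forall fun h => ?_)
    have e : pairFun u φ (x + h) - pairFun u φ x - pairDeriv u φ x h =
        u (slice φ (x + h) - slice φ x - slice (dfst h φ) x) := by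
      rw [map_sub, map_sub]; rfl
    have e2 : (slice φ (x + h) - slice φ x - slice (dfst h φ) x : 𝓓((⊤ : Opens E), ℂ)) =
        fun y => (fun z => φ (z + (h, 0)) - φ z - fderiv ℝ φ z (h, 0)) (x, y) := by
      funext y
      change φ (x + h, y) - φ (x, y) - dfst h φ (x, y) = _
      simp [dfst_coe]
    rw [e, norm_pow, norm_norm, mul_assoc]
    refine hC _ (fun y hy => ?_) _ (mul_nonneg (Finset.sum_nonneg fun i _ => hD0 i)
      (by positivity)) (fun i hi y => ?_)
    · have hz : ∀ x', (x', y) ∉ tsupport φ := fun x' h' => hy ⟨(x', y), h', rfl⟩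
      change φ (x + h, y) - φ (x, y) - dfst h φ (x, y) = 0
      rw [image_eq_zero_of_notMem_tsupport (hz _), image_eq_zero_of_notMem_tsupport (hz _),
        dfst_eq_zero _ _ (hz _)]
      simp
    · rw [e2]
      have hsm : ContDiff ℝ ∞ (fun z => φ (z + (h, 0)) - φ z - fderiv ℝ φ z (h, 0)) := by
        have hf1 : ContDiff ℝ ∞ (fderiv ℝ φ) := φ.contDiff.fderiv_right (by simp)
        exact ((φ.contDiff.comp (contDiff_id.add contDiff_const)).sub φ.contDiff).sub
          (hf1.clm_apply contDiff_const)
      refine (norm_iteratedFDeriv_comp_inr_le _ hsm i x y).trans ((hD i (h, 0) (x, y)).trans ?_)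
      have : ‖((h, 0) : E × E)‖ = ‖h‖ := by simp [Prod.norm_def]
      rw [this]
      gcongr
      exact Finset.single_le_sum (f := D) (fun i _ => hD0 i) (by simpa [Nat.lt_succ_iff] using hi)
  refine hO.trans_isLittleO ?_
  have := Asymptotics.isLittleO_norm_pow_id (E' := E) (n := 2) (by norm_num)
  simpa using this

theorem fderiv_pairFun (u : CDistribution E) (φ : 𝓓((⊤ : Opens (E × E)), ℂ)) (x v : E) :
    fderiv ℝ (pairFun u φ) x v = pairFun u (dfst v φ) x := by
  rw [(hasFDerivAt_pairFun u φ x).fderiv]; rfl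

theorem contDiff_pairFun (u : CDistribution E) (φ : 𝓓((⊤ : Opens (E × E)), ℂ)) :
    ContDiff ℝ ∞ (pairFun u φ) := by
  rw [contDiff_infty]
  intro n
  induction n generalizing φ with
  | zero =>
    exact contDiff_zero.2 (continuous_iff_continuousAt.2 fun x =>
      (hasFDerivAt_pairFun u φ x).continuousAt)
  | succ n ih =>
    push_cast
    rw [contDiff_succ_iff_fderiv_apply]
    refine ⟨fun x => (hasFDerivAt_pairFun u φ x).differentiableAt, by simp, fun v => ?_⟩
    simp_rw [fderiv_pairFun]
    exact ih _

theorem exists_bound_pairFun (u : CDistribution E) (K : Compacts (E × E)) :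
    ∃ (N : ℕ) (C : ℝ), 0 ≤ C ∧ ∀ (j : ℕ) (φ : 𝓓((⊤ : Opens (E × E)), ℂ)),
      tsupport φ ⊆ K → ∀ B : ℝ, 0 ≤ B → (∀ i ≤ N + j, ∀ z, ‖iteratedFDeriv ℝ i φ z‖ ≤ B) →
      ∀ x, ‖iteratedFDeriv ℝ j (pairFun u φ) x‖ ≤ C * B := by
  obtain ⟨N, C, hC0, hC⟩ := exists_bound u
    ⟨Prod.snd '' (K : Set (E × E)), K.isCompact.image continuous_snd⟩
  refine ⟨N, C, hC0, fun j φ hφ B hB hi x => ?_⟩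
  refine ContinuousMultilinearMap.opNorm_le_bound (by positivity) fun m => ?_
  induction j generalizing φ B with
  | zero =>
    simp only [iteratedFDeriv_zero_apply, Finset.univ_eq_empty, Finset.prod_empty, mul_one]
    refine hC _ (fun y hy => ?_) B hB (fun i hiN y => ?_)
    · exact image_eq_zero_of_notMem_tsupport (f := φ) (x := (x, y))
        fun h => hy ⟨(x, y), hφ h, rfl⟩
    · exact (norm_iteratedFDeriv_comp_inr_le φ φ.contDiff i x y).trans (hi i (by simpa using hiN) _)
  | succ j ih =>
    rw [iteratedFDeriv_succ_apply_right]
    have hf1 : ContDiff ℝ ∞ (fderiv ℝ (pairFun u φ)) :=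
      (contDiff_pairFun u φ).fderiv_right (by simp)
    have h := (ContinuousLinearMap.apply ℝ ℂ (m (Fin.last j))).iteratedFDeriv_comp_left
      (hf1.contDiffAt (x := x)) (i := j) (by exact_mod_cast le_top)
    have e : (ContinuousLinearMap.apply ℝ ℂ (m (Fin.last j))) ∘ fderiv ℝ (pairFun u φ) =
        pairFun u (dfst (m (Fin.last j)) φ) := by
      funext x; exact fderiv_pairFun u φ x _
    rw [e] at h
    have h' := congrArg (fun T => T (Fin.init m)) h
    change _ = iteratedFDeriv ℝ j (fderiv ℝ (pairFun u φ)) x (Fin.init m) (m (Fin.last j)) at h'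
    rw [← h']
    refine (ih (dfst (m (Fin.last j)) φ) ?_ (B * ‖m (Fin.last j)‖) (by positivity) ?_
      (Fin.init m)).trans (le_of_eq ?_)
    · refine closure_minimal (fun z hz => ?_) K.isCompact.isClosed
      by_contra hzK
      exact hz (dfst_eq_zero _ _ fun h => hzK (hφ h))
    · intro i hij z
      refine (norm_iteratedFDeriv_dfst_le _ φ i z).trans ?_
      gcongr
      exact hi (i + 1) (by omega) z
    · rw [Fin.prod_univ_castSucc]
      simp only [Fin.init]
      ring

/-- The map `φ ↦ (x ↦ u (y ↦ φ (x, y)))`, on the test functions supported in `K`. -/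
noncomputable def pairSndSupportedIn (u : CDistribution E) (K : Compacts (E × E)) (K' : Compacts E)
    (hK : Prod.fst '' (K : Set (E × E)) ⊆ K') : 𝓓_{K}(E × E, ℂ) →L[ℂ] 𝓓_{K'}(E, ℂ) :=
  mkSupportedIn
    (fun φ => pairFun u (TestFunction.ofSupportedIn (Set.subset_univ _) φ))
    (fun φ ψ x => pairFun_add u (TestFunction.ofSupportedIn (Set.subset_univ _) φ)
      (TestFunction.ofSupportedIn (Set.subset_univ _) ψ) x)
    (fun c φ x => pairFun_smul u c (TestFunction.ofSupportedIn (Set.subset_univ _) φ) x)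
    (fun φ => contDiff_pairFun u _)
    (fun φ x hx => pairFun_eq_zero u _ fun y =>
      φ.zero_on_compl fun h => hx (hK ⟨(x, y), h, rfl⟩))
    (fun j => by
      obtain ⟨N, C, hC0, hC⟩ := exists_bound_pairFun u K
      refine ⟨Finset.range (N + j + 1), ⟨C, hC0⟩, fun φ x => ?_⟩
      refine hC j (TestFunction.ofSupportedIn (Set.subset_univ _) φ) φ.tsupport_subset _
        (apply_nonneg _ _) (fun i hi z => ?_) x
      refine (ContDiffMapSupportedIn.norm_iteratedFDeriv_apply_le_seminorm_top ℂ (f := φ)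
        (x := z) (i := i)).trans ?_
      exact Seminorm.le_finset_sup_apply (p := fun i => N[ℂ; ℂ]_{K, i}) (x := φ)
        (Finset.mem_range.2 (Nat.lt_succ_of_le hi)))

/-- Pairing with a distribution in the second variable: the continuous linear map sending a test
function `φ` on `E × E` to the test function `x ↦ u (y ↦ φ (x, y))` on `E`. -/
noncomputable def pairSnd (u : CDistribution E) :
    𝓓((⊤ : Opens (E × E)), ℂ) →L[ℂ] 𝓓((⊤ : Opens E), ℂ) :=
  TestFunction.limitCLM ℂ
    (fun φ => ⟨fun x => u (slice φ x), contDiff_pairFun u φ,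
      HasCompactSupport.intro (φ.hasCompactSupport.image continuous_fst) (fun x hx =>
        pairFun_eq_zero u φ fun y => image_eq_zero_of_notMem_tsupport fun h => hx ⟨(x, y), h, rfl⟩),
      Set.subset_univ _⟩)
    (fun K _ => (TestFunction.ofSupportedInCLM ℂ (Set.subset_univ _)).comp
      (pairSndSupportedIn u K ⟨Prod.fst '' (K : Set (E × E)), K.isCompact.image continuous_fst⟩
        subset_rfl))
    (fun _ _ _ => rfl)

/-- The tensor product `v(x) u(y)`, a distribution on `E × E`:
`φ ↦ ⟨v(x), ⟨u(y), φ(x, y)⟩⟩`. -/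
noncomputable def tensor (v u : CDistribution E) : CDistribution (E × E) :=
  v.comp (pairSnd u)

end Pair

section Function

variable {E : Type} [NormedAddCommGroup E] [NormedSpace ℝ E] [MeasurableSpace E] [BorelSpace E]

/-- The distribution `φ ↦ ∫ φ(x) g(x) dμ(x)` defined by a locally integrable function `g`. -/
noncomputable def ofFun (μ : Measure E) (g : E → ℂ) : CDistribution E :=
  TestFunction.integralAgainstBilinCLM (ContinuousLinearMap.mul ℂ ℂ) μ g

end Function

section Shear

variable {E : Type} [NormedAddCommGroup E] [NormedSpace ℝ E]

/-- The linear automorphism `(z, y) ↦ (z - c y, y)` of `E × E` (of determinant one), the inverse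
of `(x, y) ↦ (x + c y, y)`. -/
def shear (c : E →L[ℝ] E) : (E × E) ≃L[ℝ] (E × E) :=
  ContinuousLinearEquiv.equivOfInverse
    ((ContinuousLinearMap.fst ℝ E E - c.comp (ContinuousLinearMap.snd ℝ E E)).prod
      (ContinuousLinearMap.snd ℝ E E))
    ((ContinuousLinearMap.fst ℝ E E + c.comp (ContinuousLinearMap.snd ℝ E E)).prod
      (ContinuousLinearMap.snd ℝ E E))
    (fun p => by simp) (fun p => by simp)

end Shear

/-- The distribution `f(x + c y)` on `ℝ^d × ℝ^d`, that is the composition of `f ⊗ 1` with the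
unimodular change of variables `(x, y) ↦ (x + c y, y)`. Explicitly, it is
`φ ↦ ⟨f(z), ∫ φ(z - c y, y) dy⟩`. -/
noncomputable def compAdd {d : ℕ} (f : CDistribution (EuclideanSpace ℝ (Fin d)))
    (c : Matrix (Fin d) (Fin d) ℝ) :
    CDistribution (EuclideanSpace ℝ (Fin d) × EuclideanSpace ℝ (Fin d)) :=
  (tensor f (ofFun volume fun _ => 1)).comp
    (compTest (shear (Matrix.toEuclideanCLM (𝕜 := ℝ) c)))

end CDistribution

/-- Continuous exponential polynomials on `ℝ^d`: the finite sums `∑ j, p_j(x) e^{⟨λ_j, x⟩}`, where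
the `p_j` are polynomials with complex coefficients and `λ_j ∈ ℂ^d`. -/
def IsExponentialPolynomial {d : ℕ} (g : EuclideanSpace ℝ (Fin d) → ℂ) : Prop :=
  ∃ (N : ℕ) (p : Fin N → MvPolynomial (Fin d) ℂ) (l : Fin N → Fin d → ℂ),
    ∀ x, g x = ∑ j, MvPolynomial.eval (fun i => (x i : ℂ)) (p j) *
      Complex.exp (∑ i, l j i * (x i : ℂ))

/-! Call a distribution of finite type if it lies in a finite-dimensional space of distributions
stable under all directional derivatives. The proof shows that each `f i` is of finite type, and
that finite type forces an exponential polynomial.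

For the first half, differentiate the equation in the direction `(-c_j b, b)`. Along it `x + c_j y`
is constant, so the `j`-th term disappears, while `f_i` is replaced by its derivative in the
direction `(c_i - c_j) b`, which is arbitrary because `c_i - c_j` is invertible. By the Leibniz rule
the right-hand side remains a finite sum of tensor products. Induction on the number of terms makes
all first derivatives of `f_i` of finite type, hence `f_i` itself
(`isFiniteType_of_isFiniteRank_sum`). For a single term `f(x + c y)`, pairing the variable `y` with
test functions gives averages of translates of `f`. They form a finite-dimensional space; it is
stable under derivatives because these can be moved onto the test function in `y`, and it contains
`f` because a finite-dimensional space of functionals is the annihilator of its common kernel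
(`isFiniteType_of_isFiniteRank_compAdd`, `mem_of_forall_integral_shiftTest`). Writing the pairing as
an average requires the Fubini theorem `tensor_ofFun_one_apply`.

For the second half, commuting operators on a finite-dimensional complex space split it into
simultaneous generalized eigenspaces. Multiplying by an exponential moves the eigenvalues to zero,
and a distribution on which all partial derivatives are nilpotent is a polynomial. The last point
reduces, by the Weyl commutation relations, to the fact that a distribution with zero derivatives is
constant (`Submodule.mem_of_weyl_nilpotent`, `exists_eq_smul_of_transDeriv_eq_zero`). -/

/-! ### Linear algebra: Weyl relations and simultaneous generalized eigenvectors -/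

section Algebra

variable {V ι : Type*} [AddCommGroup V] [Module ℂ V]

/-- In a module over the Weyl algebra, a submodule stable under the position operators which
contains the common kernel of the derivations contains everything on which the derivations are
nilpotent. -/
theorem Submodule.mem_of_weyl_nilpotent [Fintype ι] [DecidableEq ι] (D X : ι → Module.End ℂ V)
    (hDD : ∀ i j, Commute (D i) (D j))
    (hDX : ∀ i j g, D i (X j g) = X j (D i g) - if i = j then g else 0)
    (P : Submodule ℂ V) (hX : ∀ j, ∀ g ∈ P, X j g ∈ P)
    (h0 : ∀ g, (∀ j, D j g = 0) → g ∈ P) (N : ι → ℕ) (g : V)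
    (hg : ∀ j, (D j ^ (N j + 1)) g = 0) : g ∈ P := by
  have hDDpow : ∀ i j (m : ℕ) g, (D i ^ m) (D j g) = D j ((D i ^ m) g) := fun i j m g =>
    congrArg (fun T => T g) ((hDD i j).pow_left m).eq
  have hne : ∀ i j (m : ℕ) g, i ≠ j → (D i ^ m) (X j g) = X j ((D i ^ m) g) := by
    intro i j m g hij
    induction m with
    | zero => simp
    | succ m ih => rw [pow_succ', Module.End.mul_apply, ih, hDX, if_neg hij, sub_zero]; rfl
  have heq : ∀ j (m : ℕ) g, (D j ^ (m + 1)) (X j g) =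
      X j ((D j ^ (m + 1)) g) - ((m : ℂ) + 1) • (D j ^ m) g := by
    intro j m g
    induction m with
    | zero => simp [hDX]
    | succ m ih =>
      have e : ∀ (m : ℕ) g, (D j ^ (m + 1)) g = D j ((D j ^ m) g) := fun m g => by
        rw [pow_succ', Module.End.mul_apply]
      rw [e (m + 1) (X j g), ih, map_sub, map_smul, hDX, if_pos rfl, e (m + 1) g, ← e m g]
      push_cast
      module
  -- Induction on the total nilpotency order. The exponents are `N j + 1`, so that total order zero
  -- says exactly that every `D j` kills `g`.
  induction hS : ∑ j, N j using Nat.strong_induction_on generalizing N g with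
  | _ S ih =>
    by_cases hN : ∀ j, N j = 0
    · exact h0 g fun j => by simpa [hN j] using hg j
    push Not at hN
    obtain ⟨k, hk⟩ := hN
    obtain ⟨n, hn⟩ := Nat.exists_eq_succ_of_ne_zero hk
    have hlt : ∑ j, Function.update N k n j < S := by
      rw [← hS]
      refine Finset.sum_lt_sum (fun j _ => ?_) ⟨k, Finset.mem_univ _, by simp [hn]⟩
      by_cases hj : j = k
      · subst hj; simp [hn]
      · simp [hj]
    have hkn : (D k ^ (n + 1)) (D k g) = 0 := by
      have := hg k
      rw [hn, Nat.succ_eq_add_one, pow_succ, Module.End.mul_apply] at this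
      exact this
    have h1 : D k g ∈ P := by
      refine ih _ hlt (Function.update N k n) _ (fun j => ?_) rfl
      by_cases hj : j = k
      · subst hj; simpa using hkn
      · rw [Function.update_of_ne hj, hDDpow, hg j, map_zero]
    -- Model: `D k` is minus the partial derivative and `X k` is multiplication by `x_k`. Then `X k
    -- * D k + (n + 1)` acts on `x_k ^ r` as `n + 1 - r`, so it removes the top power `r = n + 1`
    -- and lowers the order in `k` by one.
    have h2 : X k (D k g) + ((n : ℂ) + 1) • g ∈ P := by
      refine ih _ hlt (Function.update N k n) _ (fun j => ?_) rfl
      by_cases hj : j = k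
      · subst hj
        rw [Function.update_self, map_add, heq, hkn, map_smul, map_zero, ← Module.End.mul_apply,
          ← pow_succ]
        module
      · rw [Function.update_of_ne hj, map_add, hne _ _ _ _ hj, hDDpow, map_smul, hg j]
        simp
    have h3 : ((n : ℂ) + 1) • g ∈ P := (P.add_mem_iff_right (hX k _ h1)).1 h2
    exact (P.smul_mem_iff (by exact_mod_cast Nat.succ_ne_zero n)).1 h3

/-- A submodule containing all simultaneous generalized eigenvectors of commuting endomorphisms
contains every finite-dimensional submodule stable under them. -/
theorem Submodule.le_of_genEigenvector_mem (D : ι → Module.End ℂ V)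
    (hDD : ∀ i j, Commute (D i) (D j)) (Q : Submodule ℂ V)
    (hQ : ∀ (χ : ι → ℂ) (g : V), (∀ j, ∃ k : ℕ, ((D j - χ j • (1 : Module.End ℂ V)) ^ k) g = 0) →
      g ∈ Q)
    (W : Submodule ℂ V) [FiniteDimensional ℂ W] (hW : ∀ j, ∀ g ∈ W, D j g ∈ W) : W ≤ Q := by
  let T : ι → Module.End ℂ W := fun j => (D j).restrict (hW j)
  have hT : Pairwise fun i j => Commute (T i) (T j) := fun i j _ => by
    ext g
    exact congrArg (fun A : Module.End ℂ V => A g) (hDD i j).eq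
  -- Over `ℂ` each restriction has generalized eigenspaces spanning `W`; commutation refines these
  -- to a joint decomposition.
  have htop := Module.End.iSup_iInf_maxGenEigenspace_eq_top_of_iSup_maxGenEigenspace_eq_top_of_commute
    T hT (fun i => Module.End.iSup_maxGenEigenspace_eq_top (T i))
  suffices h : (⊤ : Submodule ℂ W) ≤ Q.comap W.subtype from fun g hg => h (x := ⟨g, hg⟩) trivial
  rw [← htop]
  refine iSup_le fun χ g hg => hQ χ g fun j => ?_
  obtain ⟨k, hk⟩ := (Module.End.mem_iInf_maxGenEigenspace_iff T χ g).1 hg j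
  refine ⟨k, ?_⟩
  have key : ∀ (k : ℕ) (g : W), (((T j - χ j • (1 : Module.End ℂ W)) ^ k) g : V) =
      ((D j - χ j • (1 : Module.End ℂ V)) ^ k) g := by
    intro k
    induction k with
    | zero => simp
    | succ k ih =>
      intro g
      rw [pow_succ, pow_succ, Module.End.mul_apply, Module.End.mul_apply, ih]
      rfl
  rw [← key, hk]
  rfl

end Algebra

/-! ### Derivatives and smooth multipliers on test functions and distributions -/

namespace CDistribution

section Operators

variable {E F : Type} [NormedAddCommGroup E] [NormedSpace ℝ E]
  [NormedAddCommGroup F] [NormedSpace ℝ F]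

/-- The directional derivative of test functions. -/
noncomputable def dirDeriv (v : E) : 𝓓((⊤ : Opens E), ℂ) →L[ℂ] 𝓓((⊤ : Opens E), ℂ) :=
  TestFunction.lineDerivCLM ℂ v

theorem dirDeriv_apply (v : E) (φ : 𝓓((⊤ : Opens E), ℂ)) (x : E) :
    dirDeriv v φ x = fderiv ℝ φ x v := by
  rw [dirDeriv, TestFunction.lineDerivCLM_eq_fderivCLM, TestFunction.fderivCLM_apply_of_le]
  simp

theorem differentiable_test (φ : 𝓓((⊤ : Opens E), ℂ)) : Differentiable ℝ φ :=
  φ.contDiff.differentiable (by simp)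

theorem dirDeriv_add (v w : E) (φ : 𝓓((⊤ : Opens E), ℂ)) :
    dirDeriv (v + w) φ = dirDeriv v φ + dirDeriv w φ := by
  ext x
  change dirDeriv (v + w) φ x = dirDeriv v φ x + dirDeriv w φ x
  simp [dirDeriv_apply]

theorem dirDeriv_smul (r : ℝ) (v : E) (φ : 𝓓((⊤ : Opens E), ℂ)) :
    dirDeriv (r • v) φ = (r : ℂ) • dirDeriv v φ := by
  ext x
  change dirDeriv (r • v) φ x = (r : ℂ) * dirDeriv v φ x
  simp [dirDeriv_apply]

theorem dirDeriv_comm (v w : E) (φ : 𝓓((⊤ : Opens E), ℂ)) :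
    dirDeriv v (dirDeriv w φ) = dirDeriv w (dirDeriv v φ) := by
  have key : ∀ (v w x : E), dirDeriv v (dirDeriv w φ) x = fderiv ℝ (fderiv ℝ φ) x v w := by
    intro v w x
    rw [dirDeriv_apply, show (dirDeriv w φ : E → ℂ) = fun x => fderiv ℝ φ x w from
      funext (dirDeriv_apply w φ)]
    have hd : Differentiable ℝ (fderiv ℝ φ) :=
      (φ.contDiff.fderiv_right (m := ∞) (by simp)).differentiable (by simp)
    rw [fderiv_clm_apply (hd x) (by fun_prop)]
    simp
  ext x
  have hs : IsSymmSndFDerivAt ℝ φ x :=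
    φ.contDiff.contDiffAt.isSymmSndFDerivAt (by
      rw [minSmoothness_of_isRCLikeNormedField]; exact WithTop.coe_le_coe.2 le_top)
  rw [key, key, hs.eq]

/-- Multiplication of test functions by a smooth function. -/
noncomputable def mulTest (g : E → ℂ) (hg : ContDiff ℝ ∞ g) :
    𝓓((⊤ : Opens E), ℂ) →L[ℂ] 𝓓((⊤ : Opens E), ℂ) :=
  TestFunction.limitCLM ℂ
    (fun φ => ⟨fun x => φ x * g x, φ.contDiff.mul hg, φ.hasCompactSupport.mul_right,
      Set.subset_univ _⟩)
    (fun _ _ => (TestFunction.ofSupportedInCLM ℂ (Set.subset_univ _)).comp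
      (ContDiffMapSupportedIn.bilinLeftCLM (ContinuousLinearMap.mul ℂ ℂ) hg))
    (fun _ _ _ => rfl)

theorem mulTest_apply (g : E → ℂ) (hg : ContDiff ℝ ∞ g) (φ : 𝓓((⊤ : Opens E), ℂ)) (x : E) :
    mulTest g hg φ x = φ x * g x := rfl

theorem compTest_apply (A : E ≃L[ℝ] F) (φ : 𝓓((⊤ : Opens F), ℂ)) (x : E) :
    compTest A φ x = φ (A x) := rfl

theorem dirDeriv_compTest (A : E ≃L[ℝ] F) (v : E) (φ : 𝓓((⊤ : Opens F), ℂ)) :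
    dirDeriv v (compTest A φ) = compTest A (dirDeriv (A v) φ) := by
  ext x
  rw [compTest_apply, dirDeriv_apply, dirDeriv_apply]
  have h := ((differentiable_test φ (A x)).hasFDerivAt.comp x A.hasFDerivAt).fderiv
  change fderiv ℝ (φ ∘ A) x v = _
  rw [h]
  rfl

theorem dirDeriv_mulTest (g : E → ℂ) (hg : ContDiff ℝ ∞ g) (v : E) (φ : 𝓓((⊤ : Opens E), ℂ))
    (x : E) :
    dirDeriv v (mulTest g hg φ) x = dirDeriv v φ x * g x + φ x * fderiv ℝ g x v := by
  rw [dirDeriv_apply, dirDeriv_apply]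
  change fderiv ℝ (fun x => φ x * g x) x v = _
  rw [fderiv_fun_mul (differentiable_test φ x) (hg.differentiable (by simp) x)]
  simp
  ring

/-- The transpose of the directional derivative, acting on distributions. -/
noncomputable def transDeriv (v : E) : Module.End ℂ (CDistribution E) where
  toFun f := f.comp (dirDeriv v)
  map_add' _ _ := rfl
  map_smul' _ _ := rfl

theorem transDeriv_apply (v : E) (f : CDistribution E) (φ : 𝓓((⊤ : Opens E), ℂ)) :
    transDeriv v f φ = f (dirDeriv v φ) := rfl

theorem transDeriv_add_left (v w : E) (f : CDistribution E) :
    transDeriv (v + w) f = transDeriv v f + transDeriv w f :=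
  ContinuousLinearMap.ext fun φ => by
    change f (dirDeriv (v + w) φ) = f (dirDeriv v φ) + f (dirDeriv w φ)
    rw [dirDeriv_add, map_add]

theorem transDeriv_smul_left (r : ℝ) (v : E) (f : CDistribution E) :
    transDeriv (r • v) f = (r : ℂ) • transDeriv v f :=
  ContinuousLinearMap.ext fun φ => by
    change f (dirDeriv (r • v) φ) = (r : ℂ) • f (dirDeriv v φ)
    rw [dirDeriv_smul, map_smul]

theorem transDeriv_zero_left (f : CDistribution E) : transDeriv 0 f = 0 :=
  ContinuousLinearMap.ext fun φ => by
    have : dirDeriv (0 : E) φ = 0 := by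
      ext x
      rw [dirDeriv_apply, map_zero]
      rfl
    rw [transDeriv_apply, this, map_zero]
    rfl

theorem commute_transDeriv (v w : E) : Commute (transDeriv v) (transDeriv w) :=
  LinearMap.ext fun f => ContinuousLinearMap.ext fun φ => congrArg f (dirDeriv_comm w v φ)

/-- Multiplication of distributions by a smooth function. -/
noncomputable def smoothMul (g : E → ℂ) (hg : ContDiff ℝ ∞ g) : Module.End ℂ (CDistribution E) where
  toFun f := f.comp (mulTest g hg)
  map_add' _ _ := rfl
  map_smul' _ _ := rfl

theorem smoothMul_apply (g : E → ℂ) (hg : ContDiff ℝ ∞ g) (f : CDistribution E)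
    (φ : 𝓓((⊤ : Opens E), ℂ)) : smoothMul g hg f φ = f (mulTest g hg φ) := rfl

end Operators

section Function

variable {E : Type} [NormedAddCommGroup E] [NormedSpace ℝ E] [MeasurableSpace E] [BorelSpace E]
  {μ : Measure E}

theorem ofFun_apply [FiniteDimensional ℝ E] [IsLocallyFiniteMeasure μ]
    {g : E → ℂ} (hg : Continuous g) (φ : 𝓓((⊤ : Opens E), ℂ)) :
    ofFun μ g φ = ∫ x, φ x * g x ∂μ := by
  have := FiniteDimensional.proper_real E
  rw [ofFun, TestFunction.integralAgainstBilinCLM_eq_integral]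
  · rfl
  · exact (hg.locallyIntegrable).locallyIntegrableOn _

theorem integrable_test_mul [FiniteDimensional ℝ E] [IsLocallyFiniteMeasure μ]
    {g : E → ℂ} (hg : Continuous g) (φ : 𝓓((⊤ : Opens E), ℂ)) :
    Integrable (fun x => φ x * g x) μ := by
  have := FiniteDimensional.proper_real E
  exact (φ.continuous.mul hg).integrable_of_hasCompactSupport φ.hasCompactSupport.mul_right

theorem ofFun_add [FiniteDimensional ℝ E] [IsLocallyFiniteMeasure μ]
    {g h : E → ℂ} (hg : Continuous g) (hh : Continuous h) :
    ofFun μ (fun x => g x + h x) = ofFun μ g + ofFun μ h :=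
  ContinuousLinearMap.ext fun φ => by
    change _ = ofFun μ g φ + ofFun μ h φ
    rw [ofFun_apply hg, ofFun_apply hh, ofFun_apply (g := fun x => g x + h x) (hg.add hh),
      ← integral_add (integrable_test_mul hg φ) (integrable_test_mul hh φ)]
    simp_rw [mul_add]

theorem smoothMul_ofFun [FiniteDimensional ℝ E] [IsLocallyFiniteMeasure μ]
    {g h : E → ℂ} (hg : ContDiff ℝ ∞ g) (hh : Continuous h) :
    smoothMul g hg (ofFun μ h) = ofFun μ (fun x => g x * h x) :=
  ContinuousLinearMap.ext fun φ => by
    rw [smoothMul_apply, ofFun_apply hh, ofFun_apply (g := fun x => g x * h x) (hg.continuous.mul hh)]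
    simp_rw [mulTest_apply, mul_assoc]

/-- Integration by parts against the constant 1: a derivative of a compactly supported function has
integral zero. -/
theorem transDeriv_ofFun_one [FiniteDimensional ℝ E] [μ.IsAddHaarMeasure] (v : E) :
    transDeriv v (ofFun μ fun _ => 1) = 0 :=
  ContinuousLinearMap.ext fun φ => by
    rw [transDeriv_apply, ofFun_apply continuous_const]
    have h := integral_mul_fderiv_eq_neg_fderiv_mul_of_integrable (𝕜 := ℂ) (μ := μ)
      (f := fun _ => (1 : ℂ)) (g := φ) (v := v) (by simp) (by
        simpa [dirDeriv_apply] using integrable_test_mul (μ := μ)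
          (continuous_const (y := (1 : ℂ))) (dirDeriv v φ))
        (by simpa using integrable_test_mul (μ := μ) (continuous_const (y := (1 : ℂ))) φ)
        (fun x _ => by fun_prop) (fun x _ => differentiable_test φ x)
    simpa [dirDeriv_apply] using h

end Function

/-! ### Derivatives of tensor products and of `f(x + c y)` -/

section Tensor

variable {E : Type} [NormedAddCommGroup E] [NormedSpace ℝ E]

theorem shear_apply (c : E →L[ℝ] E) (p : E × E) : shear c p = (p.1 - c p.2, p.2) := rfl

theorem slice_dirDeriv (q : E) (φ : 𝓓((⊤ : Opens (E × E)), ℂ)) (x : E) :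
    slice (dirDeriv (0, q) φ) x = dirDeriv q (slice φ x) := by
  ext y
  rw [dirDeriv_apply]
  change dirDeriv (0, q) φ (x, y) = fderiv ℝ (φ ∘ fun y => (x, y)) y q
  have h := (differentiable_test φ (x, y)).hasFDerivAt.comp y (hasFDerivAt_prodMk_right x y)
  rw [dirDeriv_apply, h.fderiv]
  simp

variable [FiniteDimensional ℝ E]

theorem pairSnd_apply (u : CDistribution E) (φ : 𝓓((⊤ : Opens (E × E)), ℂ)) (x : E) :
    pairSnd u φ x = u (slice φ x) := rfl

theorem pairSnd_dirDeriv_fst (u : CDistribution E) (p : E) (φ : 𝓓((⊤ : Opens (E × E)), ℂ)) :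
    pairSnd u (dirDeriv (p, 0) φ) = dirDeriv p (pairSnd u φ) := by
  ext x
  rw [dirDeriv_apply]
  exact (fderiv_pairFun u φ x p).symm

theorem pairSnd_dirDeriv_snd (u : CDistribution E) (q : E) (φ : 𝓓((⊤ : Opens (E × E)), ℂ)) :
    pairSnd u (dirDeriv (0, q) φ) = pairSnd (transDeriv q u) φ := by
  ext x
  rw [pairSnd_apply, pairSnd_apply, slice_dirDeriv]
  rfl

theorem tensor_dirDeriv (v u : CDistribution E) (p q : E) (φ : 𝓓((⊤ : Opens (E × E)), ℂ)) :
    tensor v u (dirDeriv (p, q) φ) =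
      tensor (transDeriv p v) u φ + tensor v (transDeriv q u) φ := by
  change v (pairSnd u _) = v (dirDeriv p (pairSnd u φ)) + v (pairSnd _ _)
  rw [← pairSnd_dirDeriv_fst, ← pairSnd_dirDeriv_snd, ← map_add, ← map_add, ← dirDeriv_add]
  simp

theorem tensor_zero_right (v : CDistribution E) : tensor v (0 : CDistribution E) = 0 :=
  ContinuousLinearMap.ext fun φ => by
    have : pairSnd (0 : CDistribution E) φ = 0 := by ext x; rfl
    change v (pairSnd 0 φ) = 0
    rw [this, map_zero]

theorem compAdd_apply {d : ℕ} (f : CDistribution (EuclideanSpace ℝ (Fin d)))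
    (c : Matrix (Fin d) (Fin d) ℝ)
    (φ : 𝓓((⊤ : Opens (EuclideanSpace ℝ (Fin d) × EuclideanSpace ℝ (Fin d))), ℂ)) :
    compAdd f c φ = tensor f (ofFun volume fun _ => 1)
      (compTest (shear (Matrix.toEuclideanCLM (𝕜 := ℝ) c)) φ) := rfl

/-- Chain rule. The shear carries the direction `(a + c b, b)` to `(a, b)`, and in `f ⊗ 1` only the
first component of a direction contributes. In particular directions with `a + c b = 0` annihilate
`f(x + c y)`, which drives the whole argument. -/
theorem compAdd_dirDeriv {d : ℕ} (f : CDistribution (EuclideanSpace ℝ (Fin d)))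
    (c : Matrix (Fin d) (Fin d) ℝ) (a b : EuclideanSpace ℝ (Fin d))
    (φ : 𝓓((⊤ : Opens (EuclideanSpace ℝ (Fin d) × EuclideanSpace ℝ (Fin d))), ℂ)) :
    compAdd f c (dirDeriv (a, b) φ) =
      compAdd (transDeriv (a + Matrix.toEuclideanCLM (𝕜 := ℝ) c b) f) c φ := by
  have h := dirDeriv_compTest (shear (Matrix.toEuclideanCLM (𝕜 := ℝ) c))
    (a + Matrix.toEuclideanCLM (𝕜 := ℝ) c b, b) φ
  rw [shear_apply, add_sub_cancel_right] at h
  rw [compAdd_apply, compAdd_apply]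
  rw [← h, tensor_dirDeriv, transDeriv_ofFun_one, tensor_zero_right]
  simp

end Tensor

end CDistribution

/-! ### Fubini for a distribution and a measure, through a Banach space of jets -/

/-- A linear functional dominated by the norm of a linear map `J` into a normed space factors
through `J` and a continuous linear functional. -/
theorem LinearMap.exists_continuous_factor_of_bound {V B : Type*} [AddCommGroup V] [Module ℂ V]
    [NormedAddCommGroup B] [NormedSpace ℂ B] (J : V →ₗ[ℂ] B) (l : V →ₗ[ℂ] ℂ) (C : ℝ)
    (h : ∀ v, ‖l v‖ ≤ C * ‖J v‖) : ∃ L : B →L[ℂ] ℂ, ∀ v, L (J v) = l v := by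
  -- The bound makes `l` vanish on `ker J`, so it factors algebraically through `J`; the same bound
  -- gives continuity on the range, and Hahn-Banach extends to all of `B`.
  have hl : l ∈ LinearMap.range J.dualMap := by
    rw [LinearMap.range_dualMap_eq_dualAnnihilator_ker, Submodule.mem_dualAnnihilator]
    intro v hv
    have := h v
    rw [LinearMap.mem_ker.1 hv] at this
    simpa using this
  obtain ⟨g, rfl⟩ := hl
  obtain ⟨L, hL, -⟩ := exists_extension_norm_eq (LinearMap.range J)
    ((g.domRestrict (LinearMap.range J)).mkContinuous C (by rintro ⟨_, v, rfl⟩; exact h v))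
  exact ⟨L, fun v => hL ⟨J v, v, rfl⟩⟩

namespace CDistribution

/-- The Banach space of families of bounded continuous functions in which the derivatives of order
at most `N` of a test function live. -/
def JetSpace (E : Type) [NormedAddCommGroup E] [NormedSpace ℝ E] (N : ℕ) : Type :=
  (i : Fin (N + 1)) → BoundedContinuousFunction E (ContinuousMultilinearMap ℝ (fun _ : Fin i => E) ℂ)

namespace JetSpace

variable (E : Type) [NormedAddCommGroup E] [NormedSpace ℝ E] (N : ℕ)

noncomputable instance : NormedAddCommGroup (JetSpace E N) :=
  inferInstanceAs (NormedAddCommGroup ((i : Fin (N + 1)) →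
    BoundedContinuousFunction E (ContinuousMultilinearMap ℝ (fun _ : Fin i => E) ℂ)))

noncomputable instance : NormedSpace ℂ (JetSpace E N) :=
  inferInstanceAs (NormedSpace ℂ ((i : Fin (N + 1)) →
    BoundedContinuousFunction E (ContinuousMultilinearMap ℝ (fun _ : Fin i => E) ℂ)))

instance : CompleteSpace (JetSpace E N) :=
  inferInstanceAs (CompleteSpace ((i : Fin (N + 1)) →
    BoundedContinuousFunction E (ContinuousMultilinearMap ℝ (fun _ : Fin i => E) ℂ)))

variable {E N}

theorem ext {p q : JetSpace E N} (h : ∀ i x m, p i x m = q i x m) : p = q :=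
  funext fun i => BoundedContinuousFunction.ext fun x => ContinuousMultilinearMap.ext fun m => h i x m

theorem norm_apply_le (p : JetSpace E N) (i : Fin (N + 1)) (x : E) : ‖p i x‖ ≤ ‖p‖ :=
  (BoundedContinuousFunction.norm_coe_le_norm (p i) x).trans
    (norm_le_pi_norm (G := fun i : Fin (N + 1) =>
      BoundedContinuousFunction E (ContinuousMultilinearMap ℝ (fun _ : Fin i => E) ℂ)) p i)

theorem dist_le {p q : JetSpace E N} {ε : ℝ} (hε : 0 ≤ ε) (h : ∀ i x, dist (p i x) (q i x) ≤ ε) :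
    dist p q ≤ ε :=
  (dist_pi_le_iff (X := fun i : Fin (N + 1) =>
    BoundedContinuousFunction E (ContinuousMultilinearMap ℝ (fun _ : Fin i => E) ℂ)) hε).2
    fun i => (BoundedContinuousFunction.dist_le hε).2 (h i)

/-- Evaluation of one component of a jet at a point and at a family of vectors. -/
noncomputable def eval (i : Fin (N + 1)) (x : E) (m : Fin i → E) : JetSpace E N →L[ℂ] ℂ :=
  LinearMap.mkContinuous
    { toFun := fun p => p i x m
      map_add' := fun _ _ => rfl
      map_smul' := fun _ _ => rfl } (∏ j, ‖m j‖) fun p => by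
    refine ((p i x).le_opNorm m).trans ?_
    rw [mul_comm]
    exact mul_le_mul_of_nonneg_left (norm_apply_le p i x) (by positivity)

/-- The jet of a smooth function supported in a compact set. -/
noncomputable def ofSupportedIn (K : Compacts E) (N : ℕ) : 𝓓_{K}(E, ℂ) →ₗ[ℂ] JetSpace E N where
  toFun ψ i := ContDiffMapSupportedIn.structureMapLM ℂ ⊤ i ψ
  map_add' ψ χ := funext fun i => (ContDiffMapSupportedIn.structureMapLM ℂ ⊤ (i : ℕ)).map_add ψ χ
  map_smul' c ψ := funext fun i => (ContDiffMapSupportedIn.structureMapLM ℂ ⊤ (i : ℕ)).map_smul c ψ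

theorem ofSupportedIn_apply (K : Compacts E) (ψ : 𝓓_{K}(E, ℂ)) (i : Fin (N + 1)) (x : E) :
    ofSupportedIn K N ψ i x = iteratedFDeriv ℝ i ψ x := by
  change ContDiffMapSupportedIn.structureMapLM ℂ ⊤ i ψ x = _
  rw [ContDiffMapSupportedIn.structureMapLM_top_apply]

end JetSpace

section Fubini

variable {E : Type} [NormedAddCommGroup E] [NormedSpace ℝ E]

/-- Exchange of the two variables in a test function on `E × E`. -/
noncomputable def swapTest :
    𝓓((⊤ : Opens (E × E)), ℂ) →L[ℂ] 𝓓((⊤ : Opens (E × E)), ℂ) :=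
  compTest (ContinuousLinearEquiv.prodComm ℝ E E)

theorem iteratedFDeriv_apply_succ {f : E → ℂ} (hf : ContDiff ℝ ∞ f) (i : ℕ) (x : E)
    (m : Fin (i + 1) → E) :
    iteratedFDeriv ℝ (i + 1) f x m =
      iteratedFDeriv ℝ i (fun x => fderiv ℝ f x (m (Fin.last i))) x (Fin.init m) := by
  rw [iteratedFDeriv_succ_apply_right]
  have hf1 : ContDiff ℝ ∞ (fderiv ℝ f) := hf.fderiv_right (by simp)
  have h := (ContinuousLinearMap.apply ℝ ℂ (m (Fin.last i))).iteratedFDeriv_comp_left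
    (hf1.contDiffAt (x := x)) (i := i) (by exact_mod_cast le_top)
  exact (congrArg (fun T => T (Fin.init m)) h).symm

theorem iteratedFDeriv_comp_inl (f : E × E → ℂ) (hf : ContDiff ℝ ∞ f) (i : ℕ) (x y : E) :
    iteratedFDeriv ℝ i (fun x => f (x, y)) x =
      (iteratedFDeriv ℝ i f (x, y)).compContinuousLinearMap
        fun _ => ContinuousLinearMap.inl ℝ E E := by
  have hg : ContDiff ℝ ∞ (fun z => f (z + (0, y))) :=
    hf.comp (contDiff_id.add contDiff_const)
  have h := (ContinuousLinearMap.inl ℝ E E).iteratedFDeriv_comp_right hg x (i := i)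
    (by exact_mod_cast le_top)
  have e : (fun x => f (x, y)) = (fun z => f (z + (0, y))) ∘ ContinuousLinearMap.inl ℝ E E := by
    funext x; simp
  rw [e, h, iteratedFDeriv_comp_add_right]
  simp

theorem continuous_iteratedFDeriv_fst (φ : 𝓓((⊤ : Opens (E × E)), ℂ)) (i : ℕ) :
    Continuous fun z : E × E => iteratedFDeriv ℝ i (fun x => φ (x, z.2)) z.1 := by
  simp_rw [iteratedFDeriv_comp_inl φ φ.contDiff]
  exact (ContinuousMultilinearMap.compContinuousLinearMapL (𝕜 := ℝ) (F := ℂ)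
    fun _ : Fin i => ContinuousLinearMap.inl ℝ E E).continuous.comp
    (φ.contDiff.continuous_iteratedFDeriv (by exact_mod_cast le_top))

theorem iteratedFDeriv_fst_eq_zero (φ : 𝓓((⊤ : Opens (E × E)), ℂ)) (i : ℕ) {x y : E}
    (h : (x, y) ∉ tsupport φ) : iteratedFDeriv ℝ i (fun x => φ (x, y)) x = 0 := by
  have : iteratedFDeriv ℝ i φ (x, y) = 0 :=
    image_eq_zero_of_notMem_tsupport fun h' => h (tsupport_iteratedFDeriv_subset i h')
  rw [iteratedFDeriv_comp_inl φ φ.contDiff, this]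
  rfl

/-- Uniformity in the first variable is what makes `y ↦ φ(·, y)` continuous into the jet space with
its sup norms. -/
theorem uniformContinuous_iteratedFDeriv_fst (φ : 𝓓((⊤ : Opens (E × E)), ℂ)) (i : ℕ) :
    UniformContinuous fun z : E × E => iteratedFDeriv ℝ i (fun x => φ (x, z.2)) z.1 :=
  HasCompactSupport.uniformContinuous_of_continuous
    (HasCompactSupport.intro φ.hasCompactSupport fun _ hz => iteratedFDeriv_fst_eq_zero φ i hz)
    (continuous_iteratedFDeriv_fst φ i)

variable [FiniteDimensional ℝ E] [MeasurableSpace E] [BorelSpace E] (μ : Measure E)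
  [IsLocallyFiniteMeasure μ]

/-- Differentiation under the integral sign, by induction on the order: pairing in `y` commutes with
one derivative in `x`, so the last vector can be absorbed into `φ`. -/
theorem iteratedFDeriv_pairSnd_one (φ : 𝓓((⊤ : Opens (E × E)), ℂ)) (i : ℕ) (x : E)
    (m : Fin i → E) :
    iteratedFDeriv ℝ i (pairSnd (ofFun μ fun _ => 1) φ) x m =
      ∫ y, iteratedFDeriv ℝ i (fun x => φ (x, y)) x m ∂μ := by
  induction i generalizing φ with
  | zero =>
    rw [iteratedFDeriv_zero_apply, pairSnd_apply, ofFun_apply continuous_const]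
    simp only [mul_one, iteratedFDeriv_zero_apply]
    rfl
  | succ i ih =>
    rw [iteratedFDeriv_apply_succ (pairSnd _ φ).contDiff]
    have e : (fun x => fderiv ℝ (pairSnd (ofFun μ fun _ => 1) φ) x (m (Fin.last i))) =
        pairSnd (ofFun μ fun _ => 1) (dirDeriv (m (Fin.last i), 0) φ) := by
      rw [pairSnd_dirDeriv_fst]
      exact funext fun x => (dirDeriv_apply _ _ _).symm
    rw [e, ih]
    refine integral_congr_ae (Filter.Eventually.of_forall fun y => ?_)
    have hs : ContDiff ℝ ∞ fun x => φ (x, y) :=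
      φ.contDiff.comp (contDiff_id.prodMk contDiff_const)
    change _ = iteratedFDeriv ℝ (i + 1) (fun x => φ (x, y)) x m
    rw [iteratedFDeriv_apply_succ hs]
    refine congrArg (fun f : E → ℂ => iteratedFDeriv ℝ i f x (Fin.init m)) (funext fun x => ?_)
    have h := (differentiable_test φ (x, y)).hasFDerivAt.comp x (hasFDerivAt_prodMk_left (𝕜 := ℝ) x y)
    change dirDeriv _ φ (x, y) = fderiv ℝ (φ ∘ fun x => (x, y)) x _
    rw [dirDeriv_apply, h.fderiv]
    simp

/-- Fubini's theorem for a distribution in one variable and a measure in the other one. -/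
theorem tensor_ofFun_one_apply (u : CDistribution E) (φ : 𝓓((⊤ : Opens (E × E)), ℂ)) :
    tensor u (ofFun μ fun _ => 1) φ = ∫ y, u (slice (swapTest φ) y) ∂μ := by
  have := FiniteDimensional.proper_real E
  let K : Compacts E := ⟨Prod.fst '' tsupport φ, φ.hasCompactSupport.image continuous_fst⟩
  have hK : ∀ {x y : E}, x ∉ (K : Set E) → (x, y) ∉ tsupport φ := fun hx h => hx ⟨_, h, rfl⟩
  -- On functions supported in `K`, `u` has finite order `N`, hence agrees with a continuous
  -- functional `L` of the `N`-jet. The jets live in a Banach space, where a Bochner integral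
  -- commutes with `L`.
  obtain ⟨N, C, hC0, hC⟩ := exists_bound u K
  let inc : 𝓓_{K}(E, ℂ) →L[ℂ] 𝓓((⊤ : Opens E), ℂ) :=
    TestFunction.ofSupportedInCLM ℂ (Set.subset_univ _)
  obtain ⟨L, hL⟩ := (JetSpace.ofSupportedIn K N).exists_continuous_factor_of_bound
    (u.comp inc).toLinearMap C fun ψ => by
      refine hC (inc ψ) (fun x hx => ψ.zero_on_compl hx) _ (norm_nonneg _) fun i hi x => ?_
      have h1 := JetSpace.ofSupportedIn_apply K ψ ⟨i, Nat.lt_succ_of_le hi⟩ x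
      change ‖iteratedFDeriv ℝ i ψ x‖ ≤ _
      rw [← h1]
      exact JetSpace.norm_apply_le _ _ _
  let w : 𝓓_{K}(E, ℂ) := ⟨pairSnd (ofFun μ fun _ => 1) φ, (pairSnd _ φ).contDiff, fun x hx =>
    pairFun_eq_zero _ φ fun y => image_eq_zero_of_notMem_tsupport (hK hx)⟩
  let v : E → 𝓓_{K}(E, ℂ) := fun y => ⟨fun x => φ (x, y),
    φ.contDiff.comp (contDiff_id.prodMk contDiff_const), fun x hx =>
    image_eq_zero_of_notMem_tsupport (hK hx)⟩
  have hcont : Continuous fun y => JetSpace.ofSupportedIn K N (v y) := by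
    refine Metric.continuous_iff.2 fun y ε hε => ?_
    have huc := fun i : Fin (N + 1) => Metric.uniformContinuous_iff.1
      (uniformContinuous_iteratedFDeriv_fst φ i) (ε / 2) (half_pos hε)
    choose δ hδ h using huc
    refine ⟨Finset.univ.inf' Finset.univ_nonempty δ,
      (Finset.lt_inf'_iff _).2 fun i _ => hδ i, fun y' hy' => lt_of_le_of_lt ?_ (half_lt_self hε)⟩
    refine JetSpace.dist_le (half_pos hε).le fun i x => ?_
    rw [JetSpace.ofSupportedIn_apply, JetSpace.ofSupportedIn_apply]
    refine (h i (a := (x, y')) (b := (x, y)) ?_).le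
    rw [Prod.dist_eq, dist_self, max_eq_right dist_nonneg]
    exact (Finset.lt_inf'_iff _).1 hy' i (Finset.mem_univ i)
  have hint : Integrable (fun y => JetSpace.ofSupportedIn K N (v y)) μ := by
    refine hcont.integrable_of_hasCompactSupport (HasCompactSupport.intro
      (φ.hasCompactSupport.image continuous_snd) fun y hy => JetSpace.ext fun i x m => ?_)
    rw [JetSpace.ofSupportedIn_apply]
    exact congrArg (fun T => T m) (iteratedFDeriv_fst_eq_zero φ i fun h => hy ⟨_, h, rfl⟩)
  -- Point evaluations are continuous and separate jets, so the identity reduces to differentiation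
  -- under the integral sign.
  have hw : ∫ y, JetSpace.ofSupportedIn K N (v y) ∂μ = JetSpace.ofSupportedIn K N w := by
    refine JetSpace.ext fun i x m => ?_
    have h1 := (JetSpace.eval i x m).integral_comp_comm hint
    rw [JetSpace.ofSupportedIn_apply]
    change _ = iteratedFDeriv ℝ i (pairSnd (ofFun μ fun _ => 1) φ) x m
    rw [iteratedFDeriv_pairSnd_one]
    refine h1.symm.trans (integral_congr_ae (Filter.Eventually.of_forall fun y => ?_))
    exact congrArg (fun T => T m) (JetSpace.ofSupportedIn_apply K (v y) i x)
  calc tensor u (ofFun μ fun _ => 1) φ = L (JetSpace.ofSupportedIn K N w) := (hL w).symm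
    _ = ∫ y, L (JetSpace.ofSupportedIn K N (v y)) ∂μ := by rw [← hw, L.integral_comp_comm hint]
    _ = ∫ y, u (slice (swapTest φ) y) ∂μ := by
      simp_rw [hL]
      rfl

end Fubini

end CDistribution

/-! ### Translates of a distribution and averages of them -/

namespace CDistribution

section Translation

variable {E : Type} [NormedAddCommGroup E] [NormedSpace ℝ E]

/-- The tensor product `(x, y) ↦ ψ x * χ y` of two test functions. -/
noncomputable def tensorTest (ψ χ : 𝓓((⊤ : Opens E), ℂ)) : 𝓓((⊤ : Opens (E × E)), ℂ) where
  toFun z := ψ z.1 * χ z.2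
  contDiff' := (ψ.contDiff.comp contDiff_fst).mul (χ.contDiff.comp contDiff_snd)
  hasCompactSupport' := HasCompactSupport.intro (ψ.hasCompactSupport.prod χ.hasCompactSupport)
    fun z hz => by
      by_cases h : z.1 ∈ tsupport ψ
      · rw [image_eq_zero_of_notMem_tsupport (f := χ) fun h' => hz ⟨h, h'⟩, mul_zero]
      · rw [image_eq_zero_of_notMem_tsupport h, zero_mul]
  tsupport_subset' := Set.subset_univ _

theorem tensorTest_apply (ψ χ : 𝓓((⊤ : Opens E), ℂ)) (z : E × E) :
    tensorTest ψ χ z = ψ z.1 * χ z.2 := rfl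

theorem dirDeriv_tensorTest (p q : E) (ψ χ : 𝓓((⊤ : Opens E), ℂ)) :
    dirDeriv (p, q) (tensorTest ψ χ) =
      tensorTest (dirDeriv p ψ) χ + tensorTest ψ (dirDeriv q χ) := by
  ext z
  change _ = tensorTest (dirDeriv p ψ) χ z + tensorTest ψ (dirDeriv q χ) z
  have h := ((differentiable_test ψ z.1).hasFDerivAt.comp z hasFDerivAt_fst).mul
    ((differentiable_test χ z.2).hasFDerivAt.comp z hasFDerivAt_snd)
  rw [dirDeriv_apply]
  refine (congrArg (fun T : E × E →L[ℝ] ℂ => T (p, q)) h.fderiv).trans ?_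
  simp [tensorTest_apply, dirDeriv_apply]
  ring

/-- The translate `x ↦ ψ (x - a)` of a test function. -/
noncomputable def shiftTest (a : E) (ψ : 𝓓((⊤ : Opens E), ℂ)) : 𝓓((⊤ : Opens E), ℂ) where
  toFun x := ψ (x - a)
  contDiff' := ψ.contDiff.comp (contDiff_id.sub contDiff_const)
  hasCompactSupport' := ψ.hasCompactSupport.comp_homeomorph (Homeomorph.subRight a)
  tsupport_subset' := Set.subset_univ _

theorem shiftTest_zero (ψ : 𝓓((⊤ : Opens E), ℂ)) : shiftTest 0 ψ = ψ := by
  ext x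
  change ψ (x - 0) = ψ x
  rw [sub_zero]

theorem dirDeriv_shiftTest (a v : E) (ψ : 𝓓((⊤ : Opens E), ℂ)) :
    dirDeriv v (shiftTest a ψ) = shiftTest a (dirDeriv v ψ) := by
  ext x
  rw [dirDeriv_apply]
  change fderiv ℝ (fun x => ψ (x - a)) x v = dirDeriv v ψ (x - a)
  simp_rw [sub_eq_add_neg]
  rw [fderiv_comp_add_right, dirDeriv_apply]

theorem slice_swapTest_shear (c : E →L[ℝ] E) (ψ χ : 𝓓((⊤ : Opens E), ℂ)) (y : E) :
    slice (swapTest (compTest (shear c) (tensorTest ψ χ))) y = χ y • shiftTest (c y) ψ := by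
  ext x
  change ψ (x - c y) * χ y = χ y * ψ (x - c y)
  ring

/-- A smooth compactly supported real function, as a complex test function. -/
noncomputable def ofRealTest (g : E → ℝ) (hg : ContDiff ℝ ∞ g) (hc : HasCompactSupport g) :
    𝓓((⊤ : Opens E), ℂ) where
  toFun x := g x
  contDiff' := Complex.ofRealCLM.contDiff.comp hg
  hasCompactSupport' := hc.comp_left Complex.ofReal_zero
  tsupport_subset' := Set.subset_univ _

theorem ofRealTest_apply (g : E → ℝ) (hg : ContDiff ℝ ∞ g) (hc : HasCompactSupport g) (x : E) :
    ofRealTest g hg hc x = g x := rfl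

variable [FiniteDimensional ℝ E]

theorem exists_test_eventuallyEq_one (x : E) :
    ∃ χ : 𝓓((⊤ : Opens E), ℂ), ∀ᶠ y in nhds x, χ y = 1 := by
  let b : ContDiffBump x := ⟨1, 2, one_pos, one_lt_two⟩
  refine ⟨ofRealTest b b.contDiff b.hasCompactSupport, ?_⟩
  filter_upwards [b.eventuallyEq_one] with y hy
  rw [ofRealTest_apply, hy]
  simp

theorem tensor_tensorTest (v u : CDistribution E) (ψ χ : 𝓓((⊤ : Opens E), ℂ)) :
    tensor v u (tensorTest ψ χ) = u χ * v ψ := by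
  have h : pairSnd u (tensorTest ψ χ) = u χ • ψ := by
    ext x
    have e : slice (tensorTest ψ χ) x = ψ x • χ := rfl
    rw [pairSnd_apply, e, map_smul]
    exact mul_comm _ _
  change v (pairSnd u _) = _
  rw [h, map_smul, smul_eq_mul]

/-- The minus sign comes from translating by `ψ(x - y)`: differentiating in `y` is minus
differentiating in `x`. -/
theorem hasFDerivAt_apply_shiftTest (f : CDistribution E) (ψ : 𝓓((⊤ : Opens E), ℂ)) (y : E) :
    ∃ T : E →L[ℝ] ℂ, HasFDerivAt (fun y => f (shiftTest y ψ)) T y ∧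
      ∀ w, T w = -f (shiftTest y (dirDeriv w ψ)) := by
  -- The function `ψ(x - y)` is not compactly supported in the pair of variables. A cutoff in `y`,
  -- equal to 1 near the given point, turns it into a test function with the same germ there, and
  -- the smoothness of `pairFun` applies.
  obtain ⟨χ, hχ⟩ := exists_test_eventuallyEq_one y
  let c := ContinuousLinearMap.id ℝ E
  let Ψ := swapTest (compTest (shear c) (tensorTest ψ χ))
  have hslice : ∀ y, pairFun f Ψ y = χ y * f (shiftTest y ψ) := fun y => by
    rw [pairFun, slice_swapTest_shear, map_smul]
    rfl
  have heq : (fun y => f (shiftTest y ψ)) =ᶠ[nhds y] pairFun f Ψ := by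
    filter_upwards [hχ] with y hy
    rw [hslice, hy, one_mul]
  refine ⟨_, (hasFDerivAt_pairFun f Ψ y).congr_of_eventuallyEq heq, fun w => ?_⟩
  have h1 : dirDeriv (w, 0) Ψ =
      swapTest (compTest (shear c) (tensorTest (dirDeriv (-w) ψ) χ)) +
        swapTest (compTest (shear c) (tensorTest ψ (dirDeriv w χ))) := by
    rw [← map_add, ← map_add, ← dirDeriv_tensorTest]
    change dirDeriv (w, 0) (compTest _ (compTest _ _)) = _
    rw [dirDeriv_compTest, dirDeriv_compTest]
    have : shear c ((ContinuousLinearEquiv.prodComm ℝ E E) (w, 0)) = (-w, w) := by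
      rw [shear_apply]
      simp [c]
    rw [this]
    rfl
  have h2 : dirDeriv w χ y = 0 := by
    rw [dirDeriv_apply, Filter.EventuallyEq.fderiv_eq (f := fun _ => (1 : ℂ)) hχ]
    simp
  have h3 : dirDeriv (-w) ψ = -dirDeriv w ψ := by
    have := dirDeriv_smul (-1) w ψ
    simpa using this
  change pairFun f (dirDeriv (w, 0) Ψ) y = _
  rw [h1, pairFun_add, pairFun, pairFun, slice_swapTest_shear, slice_swapTest_shear, h2,
    hχ.self_of_nhds, h3, one_smul, zero_smul, map_zero, add_zero, ← map_neg f]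
  rfl

theorem continuous_apply_shiftTest (f : CDistribution E) (ψ : 𝓓((⊤ : Opens E), ℂ)) :
    Continuous fun y => f (shiftTest y ψ) :=
  continuous_iff_continuousAt.2 fun y =>
    (hasFDerivAt_apply_shiftTest f ψ y).choose_spec.1.continuousAt

variable [MeasurableSpace E] [BorelSpace E]

/-- Tested on a product, `f(x + c y)` is an average of translates of `f` with weight `χ`; this is
where Fubini is used. -/
theorem tensor_one_shear (μ : Measure E) [IsLocallyFiniteMeasure μ] (f : CDistribution E)
    (c : E →L[ℝ] E) (ψ χ : 𝓓((⊤ : Opens E), ℂ)) :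
    tensor f (ofFun μ fun _ => 1) (compTest (shear c) (tensorTest ψ χ)) =
      ∫ y, χ y * f (shiftTest (c y) ψ) ∂μ := by
  rw [tensor_ofFun_one_apply]
  simp_rw [slice_swapTest_shear, map_smul, smul_eq_mul]

/-- A distribution all of whose derivatives vanish is constant. -/
theorem exists_eq_smul_of_transDeriv_eq_zero (μ : Measure E) [μ.IsAddHaarMeasure]
    (f : CDistribution E) (hf : ∀ w, transDeriv w f = 0) :
    ∃ a : ℂ, f = a • ofFun μ fun _ => 1 := by
  -- Zero derivatives mean translation invariance.
  have hshift : ∀ ψ y, f (shiftTest y ψ) = f ψ := by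
    intro ψ y
    have hd : Differentiable ℝ fun y => f (shiftTest y ψ) := fun y =>
      (hasFDerivAt_apply_shiftTest f ψ y).choose_spec.1.differentiableAt
    have h0 : ∀ y, fderiv ℝ (fun y => f (shiftTest y ψ)) y = 0 := fun y => by
      obtain ⟨T, hT, hT'⟩ := hasFDerivAt_apply_shiftTest f ψ y
      rw [hT.fderiv]
      ext w
      rw [hT', ← dirDeriv_shiftTest, ← transDeriv_apply, hf]
      simp
    rw [is_const_of_fderiv_eq_zero hd h0 y 0, shiftTest_zero]
  -- The left side is `f` applied to the convolution of `ψ` and `χ`. Invariance gives `f(ψ * χ) = (∫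
  -- χ) f(ψ)`, and commutativity of convolution (`hcomm`) exchanges the two roles; with `∫ χ = 1`
  -- this yields `f(ψ) = f(χ) ∫ ψ`.
  have hconv : ∀ ψ χ : 𝓓((⊤ : Opens E), ℂ),
      tensor f (ofFun μ fun _ => 1) (compTest (shear (ContinuousLinearMap.id ℝ E))
        (tensorTest ψ χ)) = (∫ y, χ y ∂μ) * f ψ := fun ψ χ => by
    rw [tensor_one_shear]
    simp_rw [hshift, integral_mul_const]
  have hcomm : ∀ ψ χ : 𝓓((⊤ : Opens E), ℂ),
      pairSnd (ofFun μ fun _ => 1) (compTest (shear (ContinuousLinearMap.id ℝ E))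
        (tensorTest ψ χ)) =
      pairSnd (ofFun μ fun _ => 1) (compTest (shear (ContinuousLinearMap.id ℝ E))
        (tensorTest χ ψ)) := fun ψ χ => by
    ext z
    rw [pairSnd_apply, pairSnd_apply, ofFun_apply continuous_const, ofFun_apply continuous_const,
      ← integral_sub_left_eq_self _ μ z]
    refine integral_congr_ae (Filter.Eventually.of_forall fun y => ?_)
    change ψ (z - (z - y)) * χ (z - y) * 1 = χ (z - y) * ψ y * 1
    rw [sub_sub_cancel]
    ring
  let b : ContDiffBump (0 : E) := ⟨1, 2, one_pos, one_lt_two⟩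
  let χ : 𝓓((⊤ : Opens E), ℂ) := ofRealTest (b.normed μ) b.contDiff_normed b.hasCompactSupport_normed
  have hχ : ∫ y, χ y ∂μ = 1 := by
    change ∫ y, ((b.normed μ y : ℝ) : ℂ) ∂μ = 1
    rw [integral_complex_ofReal, b.integral_normed]
    simp
  refine ⟨f χ, ContinuousLinearMap.ext fun ψ => ?_⟩
  have h := hconv ψ χ
  rw [hχ, one_mul] at h
  rw [← h]
  change f (pairSnd _ _) = f χ * ofFun μ (fun _ => 1) ψ
  rw [hcomm, ofFun_apply continuous_const, mul_comm]
  simp_rw [mul_one]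
  exact hconv χ ψ

/-- A finite-dimensional space of distributions, defined by averages of the translates of `f`,
contains `f`. -/
theorem mem_of_forall_integral_shiftTest (μ : Measure E) [μ.IsAddHaarMeasure]
    (f : CDistribution E) (c : E →L[ℝ] E) (W : Submodule ℂ (CDistribution E))
    [FiniteDimensional ℂ W]
    (hW : ∀ χ : 𝓓((⊤ : Opens E), ℂ), ∃ w ∈ W, ∀ ψ, w ψ = ∫ y, χ y * f (shiftTest (c y) ψ) ∂μ) :
    f ∈ W := by
  let i : CDistribution E →ₗ[ℂ] Module.Dual ℂ 𝓓((⊤ : Opens E), ℂ) :=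
    ContinuousLinearMap.coeLM ℂ
  have hi : Function.Injective i := ContinuousLinearMap.coe_injective
  suffices h : i f ∈ W.map i by
    obtain ⟨w, hw, h⟩ := h
    rwa [← hi h]
  -- A finite-dimensional space of functionals is the annihilator of its common kernel, so it
  -- suffices that `f` vanishes at each `ψ` killed by `W`.
  rw [← Subspace.dualCoannihilator_dualAnnihilator_eq (W := W.map i),
    Submodule.mem_dualAnnihilator]
  intro ψ hψ
  rw [Submodule.mem_dualCoannihilator] at hψ
  have hcont : Continuous fun y => f (shiftTest (c y) ψ) :=
    (continuous_apply_shiftTest f ψ).comp c.continuous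
  -- All weighted averages of this function of `y` vanish, hence so does the function almost
  -- everywhere; by continuity it vanishes at `y = 0`, where its value is `f ψ`.
  have h0 : ∀ᵐ y ∂μ, f (shiftTest (c y) ψ) = 0 := by
    refine ae_eq_zero_of_integral_contDiff_smul_eq_zero hcont.locallyIntegrable fun g hg hgc => ?_
    obtain ⟨w, hw, h⟩ := hW (ofRealTest g hg hgc)
    have := hψ (i w) ⟨w, hw, rfl⟩
    refine Eq.trans ?_ ((h ψ).symm.trans this)
    simp_rw [ofRealTest_apply, Complex.real_smul]
  have h1 := congrFun ((hcont.ae_eq_iff_eq μ continuous_const).1 h0) 0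
  rw [map_zero, shiftTest_zero] at h1
  exact h1

end Translation

end CDistribution

/-! ### Finite type, finite rank and the elimination of terms -/

namespace CDistribution

section FiniteType

variable {E : Type} [NormedAddCommGroup E] [NormedSpace ℝ E]

/-- A distribution is of finite type if its derivatives span a finite-dimensional space. -/
def IsFiniteType (f : CDistribution E) : Prop :=
  ∃ W : Submodule ℂ (CDistribution E), FiniteDimensional ℂ W ∧ f ∈ W ∧
    ∀ w, ∀ g ∈ W, transDeriv w g ∈ W

theorem transDeriv_mem_of_basis {ι : Type*} (b : Module.Basis ι ℝ E)
    (W : Submodule ℂ (CDistribution E)) (f : CDistribution E)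
    (h : ∀ j, transDeriv (b j) f ∈ W) (w : E) : transDeriv w f ∈ W := by
  have hw : w ∈ Submodule.span ℝ (Set.range b) := by rw [b.span_eq]; trivial
  induction hw using Submodule.span_induction with
  | mem x hx => obtain ⟨j, rfl⟩ := hx; exact h j
  | zero => rw [transDeriv_zero_left]; exact W.zero_mem
  | add x y _ _ hx hy => rw [transDeriv_add_left]; exact W.add_mem hx hy
  | smul r x _ hx => rw [transDeriv_smul_left]; exact W.smul_mem _ hx

variable [FiniteDimensional ℝ E]

/-- A distribution is of finite type as soon as its first derivatives are. -/
theorem IsFiniteType.of_transDeriv {f : CDistribution E}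
    (h : ∀ w, IsFiniteType (transDeriv w f)) : IsFiniteType f := by
  -- Only basis directions are used: a sum of finitely many of the given spaces stays
  -- finite-dimensional, and adjoining the line of `f` keeps it stable.
  let b := Module.finBasis ℝ E
  choose W hfin hmem hinv using fun j => h (b j)
  have hsup : FiniteDimensional ℂ (⨆ j, W j : Submodule ℂ (CDistribution E)) :=
    Submodule.finiteDimensional_iSup W
  have hle : (⨆ j, W j) ≤ Submodule.span ℂ {f} ⊔ ⨆ j, W j := le_sup_right
  refine ⟨Submodule.span ℂ {f} ⊔ ⨆ j, W j, inferInstance,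
    Submodule.mem_sup_left (Submodule.mem_span_singleton_self f), fun w => ?_⟩
  have key : Submodule.span ℂ {f} ⊔ ⨆ j, W j ≤
      (Submodule.span ℂ {f} ⊔ ⨆ j, W j).comap (transDeriv w) := by
    refine sup_le ?_ (iSup_le fun j g hg => hle (Submodule.mem_iSup_of_mem j (hinv j w g hg)))
    rw [Submodule.span_singleton_le_iff_mem]
    exact transDeriv_mem_of_basis b _ f
      (fun j => hle (Submodule.mem_iSup_of_mem j (hmem j))) w
  exact fun g hg => key hg

/-- A distribution on `E × E` has finite rank if it is a finite sum of tensor products. -/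
def IsFiniteRank (T : CDistribution (E × E)) : Prop :=
  ∃ (κ : Type) (_ : Fintype κ) (v u : κ → CDistribution E), T = ∑ k, tensor (v k) (u k)

/-- Leibniz rule: each tensor product becomes two. -/
theorem IsFiniteRank.transDeriv {T : CDistribution (E × E)} (hT : IsFiniteRank T) (a b : E) :
    IsFiniteRank (transDeriv (a, b) T) := by
  obtain ⟨κ, _, v, u, rfl⟩ := hT
  refine ⟨κ ⊕ κ, inferInstance, Sum.elim (fun k => CDistribution.transDeriv a (v k)) v,
    Sum.elim u (fun k => CDistribution.transDeriv b (u k)), ContinuousLinearMap.ext fun φ => ?_⟩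
  rw [transDeriv_apply, Fintype.sum_sum_type]
  simp [tensor_dirDeriv, Finset.sum_add_distrib]

end FiniteType

section Induction

variable {d : ℕ}

theorem transDeriv_compAdd (f : CDistribution (EuclideanSpace ℝ (Fin d)))
    (c : Matrix (Fin d) (Fin d) ℝ) (a b : EuclideanSpace ℝ (Fin d)) :
    transDeriv (a, b) (compAdd f c) =
      compAdd (transDeriv (a + Matrix.toEuclideanCLM (𝕜 := ℝ) c b) f) c :=
  ContinuousLinearMap.ext fun φ => compAdd_dirDeriv f c a b φ

theorem compAdd_zero_left (c : Matrix (Fin d) (Fin d) ℝ) :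
    compAdd (0 : CDistribution (EuclideanSpace ℝ (Fin d))) c = 0 := rfl

theorem surjective_toEuclideanCLM {c : Matrix (Fin d) (Fin d) ℝ} (hc : IsUnit c) :
    Function.Surjective (Matrix.toEuclideanCLM (𝕜 := ℝ) c) := by
  obtain ⟨c, rfl⟩ := hc
  intro w
  refine ⟨Matrix.toEuclideanCLM (𝕜 := ℝ) ((c⁻¹ : (Matrix (Fin d) (Fin d) ℝ)ˣ) : Matrix _ _ ℝ) w, ?_⟩
  rw [← mul_apply_eq_comp, ← map_mul, Units.mul_inv, map_one]
  rfl

/-- The witness is the space of all partial pairings of `f(x + c y)` with test functions in `y`. It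
sits inside the span of the `v k`, hence is finite-dimensional; the span itself is not used because
it need not be stable under derivatives. -/
theorem isFiniteType_of_isFiniteRank_compAdd {f : CDistribution (EuclideanSpace ℝ (Fin d))}
    {c : Matrix (Fin d) (Fin d) ℝ} (hc : IsUnit c) (h : IsFiniteRank (compAdd f c)) :
    IsFiniteType f := by
  obtain ⟨κ, _, v, u, h⟩ := h
  let l : 𝓓((⊤ : Opens (EuclideanSpace ℝ (Fin d))), ℂ) →ₗ[ℂ]
      CDistribution (EuclideanSpace ℝ (Fin d)) :=
    ∑ k, (u k).toLinearMap.smulRight (v k)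
  have hl : ∀ χ ψ, l χ ψ = compAdd f c (tensorTest ψ χ) := fun χ ψ => by
    rw [h]
    simp [l, tensor_tensorTest]
  have hfin : FiniteDimensional ℂ (LinearMap.range l) := by
    have : FiniteDimensional ℂ (Submodule.span ℂ (Set.range v)) :=
      FiniteDimensional.span_of_finite ℂ (Set.finite_range v)
    refine Submodule.finiteDimensional_of_le (S₂ := Submodule.span ℂ (Set.range v)) ?_
    rintro _ ⟨χ, rfl⟩
    simp only [l, LinearMap.sum_apply, LinearMap.smulRight_apply]
    exact Submodule.sum_mem _ fun k _ =>
      Submodule.smul_mem _ _ (Submodule.subset_span ⟨k, rfl⟩)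
  refine ⟨LinearMap.range l, hfin, ?_, ?_⟩
  · refine mem_of_forall_integral_shiftTest volume f (Matrix.toEuclideanCLM (𝕜 := ℝ) c) _
      fun χ => ⟨l χ, ⟨χ, rfl⟩, fun ψ => ?_⟩
    rw [hl, compAdd_apply, tensor_one_shear]
  · rintro w _ ⟨χ, rfl⟩
    -- With `c b = -w`, the direction `(w, b)` annihilates `f(x + c y)`. So a derivative along `w`
    -- in `x` equals minus one along `b` in `y`, which falls on `χ`.
    obtain ⟨b, hb⟩ := surjective_toEuclideanCLM hc (-w)
    refine ⟨-dirDeriv b χ, ContinuousLinearMap.ext fun ψ => ?_⟩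
    have h1 := compAdd_dirDeriv f c w b (tensorTest ψ χ)
    rw [hb, add_neg_cancel, transDeriv_zero_left, compAdd_zero_left, dirDeriv_tensorTest,
      map_add, ← hl, ← hl] at h1
    rw [map_neg, transDeriv_apply]
    exact (eq_neg_of_add_eq_zero_left h1).symm

/-- Elimination of one term at a time. The family `f` is quantified inside the induction because
each step replaces its members by derivatives. -/
theorem isFiniteType_of_isFiniteRank_sum {ι : Type*} [DecidableEq ι]
    (c : ι → Matrix (Fin d) (Fin d) ℝ) (hc : ∀ i, IsUnit (c i))
    (hcc : ∀ i j, i ≠ j → IsUnit (c i - c j)) (s : Finset ι) :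
    ∀ f : ι → CDistribution (EuclideanSpace ℝ (Fin d)),
      IsFiniteRank (∑ i ∈ s, compAdd (f i) (c i)) → ∀ i ∈ s, IsFiniteType (f i) := by
  induction s using Finset.strongInduction with
  | H s ih =>
    intro f h i hi
    by_cases hs : ∃ j ∈ s, j ≠ i
    · obtain ⟨j, hj, hji⟩ := hs
      refine IsFiniteType.of_transDeriv fun w => ?_
      obtain ⟨b, rfl⟩ := surjective_toEuclideanCLM (hcc i j hji.symm) w
      -- This direction kills the term `j` and differentiates `f i` along `(c i - c j) b`, the
      -- prescribed arbitrary direction.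
      have h1 := h.transDeriv (-Matrix.toEuclideanCLM (𝕜 := ℝ) (c j) b) b
      have e : ∀ k, -Matrix.toEuclideanCLM (𝕜 := ℝ) (c j) b + Matrix.toEuclideanCLM (𝕜 := ℝ) (c k) b
          = Matrix.toEuclideanCLM (𝕜 := ℝ) (c k - c j) b := fun k => by
        rw [map_sub, neg_add_eq_sub]
        rfl
      simp_rw [map_sum, transDeriv_compAdd, e] at h1
      rw [← Finset.sum_erase s (a := j) (by
        rw [sub_self, map_zero, _root_.zero_apply, transDeriv_zero_left,
          compAdd_zero_left])] at h1
      exact ih (s.erase j) (Finset.erase_ssubset hj) _ h1 i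
        (Finset.mem_erase.2 ⟨hji.symm, hi⟩)
    · push Not at hs
      have : s = {i} := Finset.eq_singleton_iff_unique_mem.2 ⟨hi, hs⟩
      rw [this, Finset.sum_singleton] at h
      exact isFiniteType_of_isFiniteRank_compAdd (hc i) h

end Induction

end CDistribution

/-! ### From finite type to exponential polynomials -/

namespace CDistribution

section ExponentialPolynomial

variable {d : ℕ}

theorem ofFun_smul {E : Type} [NormedAddCommGroup E] [NormedSpace ℝ E] [MeasurableSpace E]
    [BorelSpace E] [FiniteDimensional ℝ E] {μ : Measure E} [IsLocallyFiniteMeasure μ] (a : ℂ)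
    {g : E → ℂ} (hg : Continuous g) : ofFun μ (fun x => a * g x) = a • ofFun μ g :=
  ContinuousLinearMap.ext fun φ => by
    change _ = a * ofFun μ g φ
    rw [ofFun_apply hg, ofFun_apply (g := fun x => a * g x) (continuous_const.mul hg),
      ← integral_const_mul]
    simp_rw [mul_left_comm]

theorem ofFun_zero {E : Type} [NormedAddCommGroup E] [NormedSpace ℝ E] [MeasurableSpace E]
    [BorelSpace E] [FiniteDimensional ℝ E] {μ : Measure E} [IsLocallyFiniteMeasure μ] :
    ofFun μ (fun _ => 0) = 0 :=
  ContinuousLinearMap.ext fun φ => by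
    rw [ofFun_apply continuous_const]
    simp

/-- The linear form `x ↦ ∑ i, l i * x i`. -/
noncomputable def complexLinearForm (l : Fin d → ℂ) : EuclideanSpace ℝ (Fin d) →L[ℝ] ℂ :=
  LinearMap.toContinuousLinearMap
    { toFun := fun x => ∑ i, l i * (x i : ℂ)
      map_add' := fun x y => by simp [mul_add, Finset.sum_add_distrib]
      map_smul' := fun r x => by
        simp only [PiLp.smul_apply, smul_eq_mul, Complex.ofReal_mul, RingHom.id_apply,
          Complex.real_smul, Finset.mul_sum]
        exact Finset.sum_congr rfl fun i _ => by ring }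

theorem complexLinearForm_apply (l : Fin d → ℂ) (x : EuclideanSpace ℝ (Fin d)) :
    complexLinearForm l x = ∑ i, l i * (x i : ℂ) := rfl

theorem complexLinearForm_single_left (j : Fin d) (x : EuclideanSpace ℝ (Fin d)) :
    complexLinearForm (Pi.single j 1) x = (x j : ℂ) := by
  rw [complexLinearForm_apply, Finset.sum_eq_single j] <;> simp +contextual

theorem complexLinearForm_single (l : Fin d → ℂ) (i : Fin d) :
    complexLinearForm l (EuclideanSpace.single i (1 : ℝ)) = l i := by
  rw [complexLinearForm_apply, Finset.sum_eq_single i] <;> simp +contextual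

theorem contDiff_exp_linear (l : Fin d → ℂ) :
    ContDiff ℝ ∞ fun x => Complex.exp (complexLinearForm l x) :=
  (complexLinearForm l).contDiff.cexp

/-- The transposed partial derivatives of distributions. -/
noncomputable def partialDeriv (i : Fin d) :
    Module.End ℂ (CDistribution (EuclideanSpace ℝ (Fin d))) :=
  transDeriv (EuclideanSpace.single i 1)

/-- Multiplication of distributions by a coordinate. -/
noncomputable def coordMul (j : Fin d) : Module.End ℂ (CDistribution (EuclideanSpace ℝ (Fin d))) :=
  smoothMul (complexLinearForm (Pi.single j 1)) (complexLinearForm _).contDiff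

/-- Multiplication of distributions by an exponential. -/
noncomputable def expMul (l : Fin d → ℂ) : Module.End ℂ (CDistribution (EuclideanSpace ℝ (Fin d))) :=
  smoothMul _ (contDiff_exp_linear l)

/-- The commutator is minus the identity for `i = j` because the transposed derivative is minus the
distributional one. -/
theorem partialDeriv_coordMul (i j : Fin d) (f : CDistribution (EuclideanSpace ℝ (Fin d))) :
    partialDeriv i (coordMul j f) = coordMul j (partialDeriv i f) - if i = j then f else 0 := by
  refine eq_sub_of_add_eq (ContinuousLinearMap.ext fun φ => ?_)
  have h : dirDeriv (EuclideanSpace.single i (1 : ℝ))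
      (mulTest (complexLinearForm (Pi.single j 1)) (complexLinearForm _).contDiff φ) =
      mulTest (complexLinearForm (Pi.single j 1)) (complexLinearForm _).contDiff
        (dirDeriv (EuclideanSpace.single i (1 : ℝ)) φ) + if i = j then φ else 0 := by
    ext x
    rw [dirDeriv_mulTest, ContinuousLinearMap.fderiv, complexLinearForm_single]
    split_ifs with hij
    · subst hij
      change _ = _ * _ + φ x
      simp
    · change _ = _ * _ + (0 : ℂ)
      simp [hij]
  change f (mulTest _ _ (dirDeriv _ φ)) + (if i = j then f else 0) φ = f (dirDeriv _ (mulTest _ _ φ))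
  rw [h, map_add]
  split_ifs <;> simp

/-- Conjugation by an exponential shifts the spectrum: a generalized eigenvector for `l` becomes a
nilpotent vector. -/
theorem partialDeriv_expMul (l : Fin d → ℂ) (j : Fin d)
    (f : CDistribution (EuclideanSpace ℝ (Fin d))) :
    partialDeriv j (expMul l f) = expMul l
      ((partialDeriv j - l j • (1 : Module.End ℂ (CDistribution (EuclideanSpace ℝ (Fin d))))) f) := by
  refine ContinuousLinearMap.ext fun φ => ?_
  have h : dirDeriv (EuclideanSpace.single j (1 : ℝ)) (mulTest _ (contDiff_exp_linear l) φ) =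
      mulTest _ (contDiff_exp_linear l) (dirDeriv (EuclideanSpace.single j (1 : ℝ)) φ) +
        l j • mulTest _ (contDiff_exp_linear l) φ := by
    ext x
    rw [dirDeriv_mulTest, ((complexLinearForm l).hasFDerivAt.cexp).fderiv]
    change _ + φ x * (Complex.exp (complexLinearForm l x) * complexLinearForm l _) =
      _ * _ + l j * (φ x * _)
    rw [complexLinearForm_single]
    ring
  change f (mulTest _ _ (dirDeriv _ φ)) =
    f (dirDeriv _ (mulTest _ (contDiff_exp_linear l) φ)) - l j • f (mulTest _ _ φ)
  rw [h, map_add, map_smul, add_sub_cancel_right]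

theorem partialDeriv_pow_expMul (l : Fin d → ℂ) (j : Fin d) (k : ℕ)
    (f : CDistribution (EuclideanSpace ℝ (Fin d))) :
    (partialDeriv j ^ k) (expMul l f) =
      expMul l
      (((partialDeriv j - l j • (1 : Module.End ℂ (CDistribution (EuclideanSpace ℝ (Fin d))))) ^ k) f) := by
  induction k generalizing f with
  | zero => rfl
  | succ k ih => rw [pow_succ, pow_succ, Module.End.mul_apply, Module.End.mul_apply,
      partialDeriv_expMul, ih]

theorem expMul_neg_expMul (l : Fin d → ℂ) (f : CDistribution (EuclideanSpace ℝ (Fin d))) :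
    expMul (-l) (expMul l f) = f := by
  refine ContinuousLinearMap.ext fun φ => congrArg f ?_
  ext x
  change φ x * Complex.exp _ * Complex.exp _ = φ x
  rw [mul_assoc, ← Complex.exp_add, complexLinearForm_apply, complexLinearForm_apply]
  simp

/-- The polynomial functions on `ℝ^d` with complex coefficients. -/
noncomputable def polyFun (p : MvPolynomial (Fin d) ℂ) (x : EuclideanSpace ℝ (Fin d)) : ℂ :=
  MvPolynomial.eval (fun i => (x i : ℂ)) p

theorem continuous_polyFun (p : MvPolynomial (Fin d) ℂ) : Continuous (polyFun p) :=
  (MvPolynomial.continuous_eval p).comp (by fun_prop)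

/-- The space of polynomial distributions. -/
noncomputable def polyDistribution (d : ℕ) :
    Submodule ℂ (CDistribution (EuclideanSpace ℝ (Fin d))) where
  carrier := {f | ∃ p : MvPolynomial (Fin d) ℂ, f = ofFun volume (polyFun p)}
  add_mem' := by
    rintro _ _ ⟨p, rfl⟩ ⟨q, rfl⟩
    refine ⟨p + q, ?_⟩
    rw [← ofFun_add (continuous_polyFun p) (continuous_polyFun q)]
    exact congrArg _ (funext fun x => (map_add _ p q).symm)
  zero_mem' := by
    refine ⟨0, ?_⟩
    rw [← ofFun_zero (μ := volume)]
    exact congrArg _ (funext fun x => by simp [polyFun])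
  smul_mem' := by
    rintro a _ ⟨p, rfl⟩
    refine ⟨MvPolynomial.C a * p, ?_⟩
    rw [← ofFun_smul a (continuous_polyFun p)]
    exact congrArg _ (funext fun x => by simp [polyFun])

theorem coordMul_mem_polyDistribution (j : Fin d) {f : CDistribution (EuclideanSpace ℝ (Fin d))}
    (hf : f ∈ polyDistribution d) : coordMul j f ∈ polyDistribution d := by
  obtain ⟨p, rfl⟩ := hf
  refine ⟨MvPolynomial.X j * p, ?_⟩
  rw [coordMul, smoothMul_ofFun _ (continuous_polyFun p)]
  exact congrArg _ (funext fun x => by simp [polyFun, complexLinearForm_single_left])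

theorem mem_polyDistribution_of_partialDeriv_eq_zero
    (f : CDistribution (EuclideanSpace ℝ (Fin d))) (hf : ∀ j, partialDeriv j f = 0) :
    f ∈ polyDistribution d := by
  obtain ⟨a, rfl⟩ := exists_eq_smul_of_transDeriv_eq_zero volume f fun w => by
    -- Taking the zero submodule passes from coordinate directions to all directions.
    have := transDeriv_mem_of_basis (EuclideanSpace.basisFun (Fin d) ℝ).toBasis ⊥ f
      (fun j => by
        rw [OrthonormalBasis.coe_toBasis, EuclideanSpace.basisFun_apply]
        exact hf j) w
    exact this
  refine (polyDistribution d).smul_mem a ⟨1, congrArg _ (funext fun x => ?_)⟩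
  simp [polyFun]

theorem mem_polyDistribution_of_nilpotent (f : CDistribution (EuclideanSpace ℝ (Fin d)))
    (hf : ∀ j, ∃ k : ℕ, (partialDeriv j ^ k) f = 0) : f ∈ polyDistribution d := by
  choose k hk using hf
  refine Submodule.mem_of_weyl_nilpotent partialDeriv coordMul
    (fun i j => commute_transDeriv _ _) (fun i j g => partialDeriv_coordMul i j g)
    (polyDistribution d) (fun j g hg => coordMul_mem_polyDistribution j hg)
    mem_polyDistribution_of_partialDeriv_eq_zero k f fun j => ?_
  -- The algebraic lemma wants exponents of the form `k j + 1`; one extra derivative is harmless.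
  rw [pow_succ', Module.End.mul_apply, hk, map_zero]

theorem _root_.IsExponentialPolynomial.continuous {g : EuclideanSpace ℝ (Fin d) → ℂ}
    (hg : IsExponentialPolynomial g) : Continuous g := by
  obtain ⟨N, p, l, h⟩ := hg
  rw [funext h]
  exact continuous_finsetSum _ fun j _ => (continuous_polyFun (p j)).mul
    (contDiff_exp_linear (l j)).continuous

theorem _root_.IsExponentialPolynomial.add {g h : EuclideanSpace ℝ (Fin d) → ℂ}
    (hg : IsExponentialPolynomial g) (hh : IsExponentialPolynomial h) :
    IsExponentialPolynomial fun x => g x + h x := by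
  obtain ⟨N, p, l, hg⟩ := hg
  obtain ⟨M, q, m, hh⟩ := hh
  refine ⟨N + M, Fin.append p q, Fin.append l m, fun x => ?_⟩
  change g x + h x = _
  rw [Fin.sum_univ_add, hg, hh]
  simp

theorem _root_.IsExponentialPolynomial.const_mul {g : EuclideanSpace ℝ (Fin d) → ℂ} (a : ℂ)
    (hg : IsExponentialPolynomial g) : IsExponentialPolynomial fun x => a * g x := by
  obtain ⟨N, p, l, hg⟩ := hg
  refine ⟨N, fun j => MvPolynomial.C a * p j, l, fun x => ?_⟩
  change a * g x = _
  rw [hg, Finset.mul_sum]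
  simp [mul_assoc]

/-- The space of distributions given by exponential polynomials. -/
noncomputable def expPolyDistribution (d : ℕ) :
    Submodule ℂ (CDistribution (EuclideanSpace ℝ (Fin d))) where
  carrier := {f | ∃ g, IsExponentialPolynomial g ∧ f = ofFun volume g}
  add_mem' := by
    rintro _ _ ⟨g, hg, rfl⟩ ⟨h, hh, rfl⟩
    exact ⟨_, hg.add hh, (ofFun_add hg.continuous hh.continuous).symm⟩
  zero_mem' := by
    exact ⟨_, ⟨0, Fin.elim0, Fin.elim0, fun x => (Fin.sum_univ_zero _).symm⟩, ofFun_zero.symm⟩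
  smul_mem' := by
    rintro a _ ⟨g, hg, rfl⟩
    exact ⟨_, hg.const_mul a, (ofFun_smul a hg.continuous).symm⟩

/-- Multiplying by the exponential of `l` gives a polynomial; undoing it gives the frequency `-l`,
the sign again due to transposition. -/
theorem mem_expPolyDistribution_of_genEigenvector (l : Fin d → ℂ)
    (f : CDistribution (EuclideanSpace ℝ (Fin d)))
    (hf : ∀ j, ∃ k : ℕ, ((partialDeriv j -
      l j • (1 : Module.End ℂ (CDistribution (EuclideanSpace ℝ (Fin d))))) ^ k) f = 0) :
    f ∈ expPolyDistribution d := by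
  obtain ⟨p, hp⟩ := mem_polyDistribution_of_nilpotent (expMul l f) fun j => by
    obtain ⟨k, hk⟩ := hf j
    exact ⟨k, by rw [partialDeriv_pow_expMul, hk, map_zero]⟩
  refine ⟨fun x => Complex.exp (complexLinearForm (-l) x) * polyFun p x,
    ⟨1, fun _ => p, fun _ => -l, fun x => ?_⟩, ?_⟩
  · rw [Fin.sum_univ_one, mul_comm]
    rfl
  · rw [← smoothMul_ofFun (contDiff_exp_linear (-l)) (continuous_polyFun p), ← hp]
    exact (expMul_neg_expMul l f).symm

theorem IsFiniteType.mem_expPolyDistribution {f : CDistribution (EuclideanSpace ℝ (Fin d))}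
    (hf : IsFiniteType f) : f ∈ expPolyDistribution d := by
  obtain ⟨W, _, hfW, hW⟩ := hf
  exact Submodule.le_of_genEigenvector_mem partialDeriv (fun i j => commute_transDeriv _ _)
    (expPolyDistribution d) mem_expPolyDistribution_of_genEigenvector W
    (fun j g hg => hW _ g hg) hfW

end ExponentialPolynomial

end CDistribution

theorem mainTheorem6 (d m n : ℕ)
    (f : Fin m → CDistribution (EuclideanSpace ℝ (Fin d)))
    (u v : Fin n → CDistribution (EuclideanSpace ℝ (Fin d)))
    (c : Fin m → Matrix.GeneralLinearGroup (Fin d) ℝ)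
    (hc : ∀ i j, i ≠ j →
      IsUnit ((c i : Matrix (Fin d) (Fin d) ℝ) - (c j : Matrix (Fin d) (Fin d) ℝ)))
    (h : ∑ i, CDistribution.compAdd (f i) (c i : Matrix (Fin d) (Fin d) ℝ) =
      ∑ k, CDistribution.tensor (v k) (u k)) :
    ∀ i, ∃ g : EuclideanSpace ℝ (Fin d) → ℂ,
      IsExponentialPolynomial g ∧ f i = CDistribution.ofFun MeasureTheory.volume g := by
  have hrank : CDistribution.IsFiniteRank
      (∑ i, CDistribution.compAdd (f i) (c i : Matrix (Fin d) (Fin d) ℝ)) :=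
    ⟨Fin n, inferInstance, v, u, h⟩
  exact fun i => (CDistribution.isFiniteType_of_isFiniteRank_sum
    (fun i => (c i : Matrix (Fin d) (Fin d) ℝ)) (fun i => (c i).isUnit) hc Finset.univ f hrank i
    (Finset.mem_univ i)).mem_expPolyDistribution
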